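/- Let $I$ be a finite set, and for each $i\in I$ let $A_i$ be a unital C*-algebra. Let $A=\bigotimes_{i\in I}A_i$ be the minimal (spatial) C*-tensor product, and let $\tilde A_i\subseteq A$ be the C*-subalgebra $\bigotimes_{j\ne i}A_j$, i.e. the closed $*$-subalgebra generated by the elementary tensors $\otimes_j a_j$ with $a_i=1$. For $a\in A$ put $$L_i(a)=2\inf\{\|a-c\|:c\in\tilde A_i\},\qquad L_{qH}(a)=\max_{i\in I}L_i(a).$$ For states $\mu,\nu$ of $A$ put $d_{qH}(\mu,\nu)=\sup\{|\mu(a)-\nu(a)|:a\in A,\ L_{qH}(a)\le 1\}$. For a bounded linear functional $\varphi$ on $A$ that vanishes on $\tilde A_i$ put $\|\varphi\|_i=\sup\{|\varphi(a)|:a\in A,\ L_i(a)\le 1\}$, and let $\varphi^*(a)=\overline{\varphi(a^*)}$. (1) For all states $\mu,\nu$ of $A$ the number $d_{qH}(\mu,\nu)$ is finite, and $$d_{qH}(\mu,\nu)=\inf\Big\{\sum_{i}\|\varphi_i\|_i:\ \varphi_i\in A',\ \varphi_i|_{\tilde A_i}=0,\ \varphi_i^*=\varphi_i,\ \mu-\nu=\sum_i\varphi_i\Big\}.$$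 (2) Suppose that each $A_i$ is a full matrix algebra $M_{n_i}(\mathbb C)$, so that $A$ is the algebra of matrices indexed by $\prod_i\{1,\dots,n_i\}$. Then the relation $\mu(\otimes_i a_i)=\operatorname{Tr}(\rho\,(\otimes_i a_i))$ for all $a_i \in A_i$ is a bijection between the states $\mu$ of $A$ and the density matrices $\rho$, and if $\mu,\nu$ correspond to $\rho,\sigma$, then $d_{qH}(\mu,\nu)$ is the quantum Wasserstein distance of order 1 of De Palma, Marvian, Trevisan and Lloyd: $$d_{qH}(\mu,\nu)=\tfrac12\inf\Big\{\sum_i\|X_i\|_1:\ X_i=X_i^*,\ \operatorname{Tr}_iX_i=0,\ \rho-\sigma=\sum_iX_i\Big\}$$ $$=\inf\Big\{\sum_ic_i:\ c_i\ge 0,\ \rho-\sigma=\sum_ic_i(\rho_i-\sigma_i),\ \rho_i,\sigma_i\text{ density matrices with }\operatorname{Tr}_i\rho_i=\operatorname{Tr}_i\sigma_i\Big\},$$ where $\operatorname{Tr}_i$ is the partial trace over the $i$-th factor and $\|\cdot\|_1$ is the trace norm. -/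

import Mathlib

open scoped ENNReal NNReal ComplexOrder

noncomputable section

namespace QHamming

section HilbertTensor

variable {ι : Type*} [Fintype ι]

/-- The algebraic tensor product of a finite family of Hilbert spaces. It is a type synonym that
will carry the norm coming from the inner product (and not a cross norm of Banach spaces). -/
def PreTensor {ι : Type*} [Fintype ι] (H : ι → Type*) [∀ i, NormedAddCommGroup (H i)]
    [∀ i, InnerProductSpace ℂ (H i)] : Type _ :=
  PiTensorProduct ℂ H

variable (H : ι → Type*) [∀ i, NormedAddCommGroup (H i)] [∀ i, InnerProductSpace ℂ (H i)]

instance : AddCommGroup (PreTensor H) := inferInstanceAs (AddCommGroup (PiTensorProduct ℂ H))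
instance : Module ℂ (PreTensor H) := inferInstanceAs (Module ℂ (PiTensorProduct ℂ H))

variable {H}

/-- The elementary tensor `⊗ ξᵢ` in the algebraic tensor product. -/
def preTprod (ξ : ∀ i, H i) : PreTensor H := PiTensorProduct.tprod ℂ ξ

/-- The linear functional `η ↦ ⟪⊗ ξᵢ, η⟫`. -/
def innerFunctional (ξ : ∀ i, H i) : PreTensor H →ₗ[ℂ] ℂ :=
  PiTensorProduct.lift ((MultilinearMap.mkPiAlgebra ℂ ι ℂ).compLinearMap
    (fun i => (innerSL ℂ (ξ i)).toLinearMap))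

theorem innerFunctional_preTprod (ξ η : ∀ i, H i) :
    innerFunctional ξ (preTprod η) = ∏ i, inner ℂ (ξ i) (η i) := by
  unfold innerFunctional preTprod
  erw [PiTensorProduct.lift.tprod]
  simp

theorem preTensor_ext {f g : PreTensor H →ₗ[ℂ] ℂ} (h : ∀ ξ, f (preTprod ξ) = g (preTprod ξ)) :
    f = g :=
  PiTensorProduct.ext (R := ℂ) (MultilinearMap.ext h)

theorem innerFunctional_update_add [DecidableEq ι] (ξ : ∀ i, H i) (i : ι) (a b : H i) :
    innerFunctional (Function.update ξ i (a + b)) =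
      innerFunctional (Function.update ξ i a) + innerFunctional (Function.update ξ i b) := by
  refine preTensor_ext fun η => ?_
  have key : ∀ c : H i, ∏ j, inner ℂ (Function.update ξ i c j) (η j) =
      inner ℂ c (η i) * ∏ j ∈ Finset.univ.erase i, inner ℂ (ξ j) (η j) := by
    intro c
    rw [← Finset.mul_prod_erase _ _ (Finset.mem_univ i)]
    congr 1
    · simp
    · refine Finset.prod_congr rfl fun j hj => ?_
      rw [Function.update_of_ne (Finset.ne_of_mem_erase hj)]
  simp only [LinearMap.add_apply, innerFunctional_preTprod, key, inner_add_left, add_mul]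

theorem innerFunctional_update_smul [DecidableEq ι] (ξ : ∀ i, H i) (i : ι) (c : ℂ) (a : H i) :
    innerFunctional (Function.update ξ i (c • a)) =
      starRingEnd ℂ c • innerFunctional (Function.update ξ i a) := by
  refine preTensor_ext fun η => ?_
  have key : ∀ c : H i, ∏ j, inner ℂ (Function.update ξ i c j) (η j) =
      inner ℂ c (η i) * ∏ j ∈ Finset.univ.erase i, inner ℂ (ξ j) (η j) := by
    intro c
    rw [← Finset.mul_prod_erase _ _ (Finset.mem_univ i)]
    congr 1
    · simp
    · refine Finset.prod_congr rfl fun j hj => ?_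
      rw [Function.update_of_ne (Finset.ne_of_mem_erase hj)]
  simp only [LinearMap.smul_apply, innerFunctional_preTprod, key, inner_smul_left, smul_eq_mul,
    mul_assoc]

/-- The sesquilinear form, linear in the first and conjugate linear in the second argument, with
`(⊗ ξᵢ, η) ↦ conj ⟪⊗ ξᵢ, η⟫`. -/
def innerForm : PreTensor H →ₗ[ℂ] (PreTensor H →ₛₗ[starRingEnd ℂ] ℂ) :=
  PiTensorProduct.lift
    { toFun := fun ξ =>
        { toFun := fun η => starRingEnd ℂ (innerFunctional ξ η)
          map_add' := fun x y => by simp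
          map_smul' := fun c x => by simp }
      map_update_add' := by
        intro _ ξ i a b
        ext η
        simp [innerFunctional_update_add]
      map_update_smul' := by
        intro _ ξ i c a
        ext η
        simp [innerFunctional_update_smul] }

theorem innerForm_preTprod (ξ : ∀ i, H i) (η : PreTensor H) :
    innerForm (preTprod ξ) η = starRingEnd ℂ (innerFunctional ξ η) := by
  unfold innerForm preTprod
  erw [PiTensorProduct.lift.tprod]
  rfl

theorem innerForm_preTprod_preTprod (ξ η : ∀ i, H i) :
    innerForm (preTprod ξ) (preTprod η) = ∏ i, inner ℂ (η i) (ξ i) := by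
  rw [innerForm_preTprod, innerFunctional_preTprod, map_prod]
  simp

theorem exists_sum (x : PreTensor H) :
    ∃ (n : ℕ) (c : Fin n → ℂ) (v : Fin n → ∀ i, H i), x = ∑ k, c k • preTprod (v k) := by
  have hx : x ∈ Submodule.span ℂ (Set.range (preTprod (H := H))) := by
    have h1 := PiTensorProduct.span_tprod_eq_top (R := ℂ) (s := H)
    have h2 : (x : PiTensorProduct ℂ H) ∈ (⊤ : Submodule ℂ (PiTensorProduct ℂ H)) := trivial
    rw [← h1] at h2
    exact h2
  obtain ⟨n, c, g, hg⟩ := Submodule.mem_span_set'.mp hx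
  choose v hv using fun k => (g k).2
  exact ⟨n, c, v, by simp only [hv, hg]⟩

/-- The product kernel of inner products is positive semidefinite. -/
theorem posSemidef_kernel {n : Type*} [Fintype n] (v : n → ∀ i, H i) (s : Finset ι) :
    (Matrix.of fun k l => ∏ i ∈ s, inner ℂ (v k i) (v l i)).PosSemidef := by
  classical
  induction s using Finset.induction_on with
  | empty =>
    have h1 : (Matrix.of fun k l => ∏ i ∈ (∅ : Finset ι), inner ℂ (v k i) (v l i)) =
        Matrix.gram ℂ (fun _ : n => (1 : ℂ)) := by
      ext k l
      simp [Matrix.gram]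
    rw [h1]
    exact Matrix.posSemidef_gram (𝕜 := ℂ) (fun _ : n => (1 : ℂ))
  | insert i s hi ih =>
    have h1 : (Matrix.of fun k l => ∏ i ∈ insert i s, inner ℂ (v k i) (v l i)) =
        (Matrix.gram ℂ (fun k => v k i)).hadamard
          (Matrix.of fun k l => ∏ i ∈ s, inner ℂ (v k i) (v l i)) := by
      ext k l
      simp [Matrix.gram, Finset.prod_insert hi]
    rw [h1]
    exact (Matrix.posSemidef_gram (𝕜 := ℂ) (fun k => v k i)).hadamard ih

theorem innerForm_sum {n : ℕ} (c : Fin n → ℂ) (v : Fin n → ∀ i, H i) :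
    innerForm (∑ k, c k • preTprod (v k)) (∑ k, c k • preTprod (v k)) =
      star c ⬝ᵥ (Matrix.of fun k l => ∏ i, inner ℂ (v k i) (v l i)).mulVec c := by
  simp only [map_sum, LinearMap.sum_apply, map_smul, LinearMap.smul_apply,
    LinearMap.map_smulₛₗ, innerForm_preTprod_preTprod, smul_eq_mul, dotProduct, Matrix.mulVec,
    Finset.mul_sum, Matrix.of_apply, Pi.star_apply, RCLike.star_def]
  refine Finset.sum_congr rfl fun k _ => Finset.sum_congr rfl fun l _ => ?_
  ring

theorem innerForm_conj_symm (x y : PreTensor H) :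
    starRingEnd ℂ (innerForm x y) = innerForm y x := by
  obtain ⟨n, c, v, rfl⟩ := exists_sum x
  obtain ⟨m, d, w, rfl⟩ := exists_sum y
  simp only [map_sum, LinearMap.sum_apply, map_smul, LinearMap.smul_apply,
    LinearMap.map_smulₛₗ, innerForm_preTprod_preTprod, smul_eq_mul, map_mul, map_prod,
    inner_conj_symm, RCLike.conj_conj, Finset.mul_sum]
  rw [Finset.sum_comm]
  refine Finset.sum_congr rfl fun k _ => Finset.sum_congr rfl fun l _ => ?_
  ring

/-- The (semi-)inner product with `⟪⊗ ξᵢ, ⊗ ηᵢ⟫ = ∏ᵢ ⟪ξᵢ, ηᵢ⟫`. -/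
abbrev preTensorCore : PreInnerProductSpace.Core ℂ (PreTensor H) where
  inner x y := innerForm y x
  conj_inner_symm x y := innerForm_conj_symm x y
  re_inner_nonneg x := by
    obtain ⟨n, c, v, rfl⟩ := exists_sum x
    rw [innerForm_sum]
    exact (Complex.nonneg_iff.mp ((posSemidef_kernel v Finset.univ).dotProduct_mulVec_nonneg c)).1
  add_left x y z := by simp
  smul_left x y r := by simp

instance : SeminormedAddCommGroup (PreTensor H) :=
  InnerProductSpace.Core.toSeminormedAddCommGroup (c := preTensorCore)
instance : InnerProductSpace ℂ (PreTensor H) :=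
  InnerProductSpace.ofCore preTensorCore

theorem inner_eq_innerForm (x y : PreTensor H) : inner ℂ x y = innerForm y x := rfl

theorem inner_preTprod (ξ η : ∀ i, H i) :
    inner ℂ (preTprod ξ) (preTprod η) = ∏ i, inner ℂ (ξ i) (η i) := by
  rw [inner_eq_innerForm, innerForm_preTprod_preTprod]

variable (H) in
/-- The Hilbert space tensor product `⊗ᵢ Hᵢ`. -/
abbrev HilbertTensor : Type _ := UniformSpace.Completion (PreTensor H)

/-- The algebraic tensor product of operators. -/
def preMap (T : ∀ i, H i →L[ℂ] H i) : PreTensor H →ₗ[ℂ] PreTensor H :=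
  PiTensorProduct.map fun i => (T i).toLinearMap

theorem preMap_preTprod (T : ∀ i, H i →L[ℂ] H i) (ξ : ∀ i, H i) :
    preMap T (preTprod ξ) = preTprod fun i => T i (ξ i) :=
  PiTensorProduct.map_tprod _ _

theorem preMap_mul (S T : ∀ i, H i →L[ℂ] H i) (x : PreTensor H) :
    preMap (fun i => S i * T i) x = preMap S (preMap T x) := by
  obtain ⟨n, c, v, rfl⟩ := exists_sum x
  simp [preMap_preTprod]

theorem preMap_one (x : PreTensor H) : preMap (fun i => (1 : H i →L[ℂ] H i)) x = x := by
  obtain ⟨n, c, v, rfl⟩ := exists_sum x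
  simp [preMap_preTprod]

theorem norm_preMap_single_le [DecidableEq ι] (i : ι) (T : H i →L[ℂ] H i) (x : PreTensor H) :
    ‖preMap (Function.update (fun j => (1 : H j →L[ℂ] H j)) i T) x‖ ≤ ‖T‖ * ‖x‖ := by
  obtain ⟨n, c, v, rfl⟩ := exists_sum x
  set w : Fin n → ∀ j, H j := fun k => Function.update (v k) i (T (v k i)) with hw
  have h1 : preMap (Function.update (fun j => (1 : H j →L[ℂ] H j)) i T)
      (∑ k, c k • preTprod (v k)) = ∑ k, c k • preTprod (w k) := by
    simp only [map_sum, map_smul, preMap_preTprod]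
    refine Finset.sum_congr rfl fun k _ => ?_
    congr 2
    funext j
    by_cases hj : j = i
    · subst hj; simp [hw]
    · simp [hw, hj]
  have hn : ∀ x : PreTensor H, ‖x‖ ^ 2 = (innerForm x x).re := fun x =>
    InnerProductSpace.norm_sq_eq_re_inner (𝕜 := ℂ) x
  rw [h1, ← sq_le_sq₀ (norm_nonneg _) (by positivity), mul_pow, hn, hn, innerForm_sum,
    innerForm_sum]
  have hpos := ((Matrix.posSemidef_opNorm_smul_gram_sub_gram (𝕜 := ℂ) (fun k => v k i) T).hadamard
    (posSemidef_kernel v (Finset.univ.erase i))).dotProduct_mulVec_nonneg c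
  have hmat : ((‖T‖ ^ 2 • Matrix.gram ℂ (fun k => v k i) -
      Matrix.gram ℂ (T ∘ fun k => v k i)).hadamard
      (Matrix.of fun k l => ∏ j ∈ Finset.univ.erase i, inner ℂ (v k j) (v l j))) =
      ((‖T‖ ^ 2 : ℝ) : ℂ) • (Matrix.of fun k l => ∏ j, inner ℂ (v k j) (v l j)) -
        (Matrix.of fun k l => ∏ j, inner ℂ (w k j) (w l j)) := by
    ext k l
    have e1 : ∏ j ∈ Finset.univ.erase i, inner ℂ (w k j) (w l j) =
        ∏ j ∈ Finset.univ.erase i, inner ℂ (v k j) (v l j) := by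
      refine Finset.prod_congr rfl fun j hj => ?_
      simp [hw, Finset.ne_of_mem_erase hj]
    simp only [Matrix.hadamard_apply, Matrix.sub_apply, Matrix.smul_apply, Matrix.of_apply,
      ← Finset.mul_prod_erase Finset.univ _ (Finset.mem_univ i), e1, Matrix.gram_apply]
    simp [hw]
    ring
  rw [hmat, Matrix.sub_mulVec, Matrix.smul_mulVec, dotProduct_sub, dotProduct_smul] at hpos
  have hre := (Complex.nonneg_iff.mp hpos).1
  rw [Complex.sub_re, smul_eq_mul, Complex.re_ofReal_mul] at hre
  exact sub_nonneg.mp hre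

theorem exists_norm_preMap_le (T : ∀ i, H i →L[ℂ] H i) :
    ∃ C, ∀ x, ‖preMap T x‖ ≤ C * ‖x‖ := by
  classical
  have key : ∀ s : Finset ι, ∃ C, 0 ≤ C ∧
      ∀ x, ‖preMap (fun i => if i ∈ s then T i else 1) x‖ ≤ C * ‖x‖ := by
    intro s
    induction s using Finset.induction_on with
    | empty => exact ⟨1, zero_le_one, fun x => by simp [preMap_one]⟩
    | insert i s hi ih =>
      obtain ⟨C, hC, h⟩ := ih
      refine ⟨‖T i‖ * C, by positivity, fun x => ?_⟩
      have e : (fun j => if j ∈ insert i s then T j else 1) =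
          fun j => Function.update (fun j => (1 : H j →L[ℂ] H j)) i (T i) j *
            (if j ∈ s then T j else 1) := by
        funext j
        by_cases hj : j = i
        · subst hj; simp [hi]
        · simp [hj]
      rw [e, preMap_mul, mul_assoc]
      exact (norm_preMap_single_le i (T i) _).trans
        (mul_le_mul_of_nonneg_left (h x) (norm_nonneg _))
  obtain ⟨C, -, h⟩ := key Finset.univ
  exact ⟨C, fun x => by simpa using h x⟩

/-- The elementary tensor `⊗ ξᵢ` in the Hilbert space tensor product. -/
def vecTensor (ξ : ∀ i, H i) : HilbertTensor H := (preTprod ξ : PreTensor H)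

/-- The bounded operator `⊗ᵢ Tᵢ` on `⊗ᵢ Hᵢ`. -/
def opTensor (T : ∀ i, H i →L[ℂ] H i) : HilbertTensor H →L[ℂ] HilbertTensor H :=
  ((preMap T).mkContinuousOfExistsBound (exists_norm_preMap_le T)).completion

theorem inner_vecTensor (ξ η : ∀ i, H i) :
    inner ℂ (vecTensor ξ) (vecTensor η) = ∏ i, inner ℂ (ξ i) (η i) := by
  rw [vecTensor, vecTensor, UniformSpace.Completion.inner_coe, inner_preTprod]

theorem opTensor_vecTensor (T : ∀ i, H i →L[ℂ] H i) (ξ : ∀ i, H i) :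
    opTensor T (vecTensor ξ) = vecTensor fun i => T i (ξ i) := by
  rw [opTensor, vecTensor, ContinuousLinearMap.completion_apply_coe]
  exact congrArg _ (preMap_preTprod T ξ)

end HilbertTensor

section MinTensor

variable {ι : Type*} [Fintype ι] {A : ι → Type*} [∀ i, CStarAlgebra (A i)]
  {H : ι → Type*} [∀ i, NormedAddCommGroup (H i)] [∀ i, InnerProductSpace ℂ (H i)]
  [∀ i, CompleteSpace (H i)]

/-- The spatial (minimal) C*-tensor product `⊗ᵢ Aᵢ` of unital C*-algebras given with faithful
unital representations `πᵢ` on Hilbert spaces `Hᵢ`: the norm closed *-algebra of operators on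
`⊗ᵢ Hᵢ` generated by the operators `⊗ᵢ πᵢ(aᵢ)`. -/
def minTensor (π : ∀ i, A i →⋆ₐ[ℂ] (H i →L[ℂ] H i)) :
    StarSubalgebra ℂ (HilbertTensor H →L[ℂ] HilbertTensor H) :=
  (StarAlgebra.adjoin ℂ
    (Set.range fun a : ∀ i, A i => opTensor fun i => π i (a i))).topologicalClosure

variable (π : ∀ i, A i →⋆ₐ[ℂ] (H i →L[ℂ] H i))

/-- The elementary tensor `⊗ᵢ aᵢ` in `⊗ᵢ Aᵢ`. -/
def elemTensor (a : ∀ i, A i) : minTensor π :=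
  ⟨opTensor fun i => π i (a i),
    StarSubalgebra.le_topologicalClosure _ (StarAlgebra.subset_adjoin ℂ _ ⟨a, rfl⟩)⟩

/-- The C*-subalgebra `Ãᵢ = ⊗_{j ≠ i} Aⱼ` of `⊗ⱼ Aⱼ`, generated by the elementary tensors whose
`i`-th factor is `1`. -/
def tilde (i : ι) : StarSubalgebra ℂ (minTensor π) :=
  (StarAlgebra.adjoin ℂ {x | ∃ a : ∀ j, A j, a i = 1 ∧ x = elemTensor π a}).topologicalClosure

/-- `Lᵢ(a) = 2 inf {‖a - c‖ : c ∈ Ãᵢ}`. -/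
def partialL (i : ι) (a : minTensor π) : ℝ := 2 * ⨅ c : tilde π i, ‖a - c‖

/-- The quantum Hamming seminorm `L_qH(a) = maxᵢ Lᵢ(a)`. -/
def hammingL (a : minTensor π) : ℝ := ⨆ i, partialL π i a

/-- The distance on states (with values in `[0, ∞]`) determined by `L_qH`. -/
def hammingDist (μ ν : minTensor π →L[ℂ] ℂ) : ℝ≥0∞ :=
  ⨆ (a : minTensor π) (_ : hammingL π a ≤ 1), ENNReal.ofReal ‖μ a - ν a‖

/-- The norm (with values in `[0, ∞]`) dual to `Lᵢ`. -/
def dualNorm (i : ι) (φ : minTensor π →L[ℂ] ℂ) : ℝ≥0∞ :=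
  ⨆ (a : minTensor π) (_ : partialL π i a ≤ 1), ENNReal.ofReal ‖φ a‖

end MinTensor

/-- A state on a unital C*-algebra: a positive linear functional of norm one. -/
def IsState {B : Type*} [NormedRing B] [StarRing B] [NormedAlgebra ℂ B] (φ : B →L[ℂ] ℂ) : Prop :=
  (∀ b, 0 ≤ φ (star b * b)) ∧ ‖φ‖ = 1

/-- The functionals with `φ = φ*`, where `φ*(b) = conj φ(b*)`. -/
def IsSelfAdjointFunctional {B : Type*} [NormedRing B] [StarRing B] [NormedAlgebra ℂ B]
    (φ : B →L[ℂ] ℂ) : Prop :=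
  ∀ b, starRingEnd ℂ (φ (star b)) = φ b

section Matrices

variable {ι : Type*} [Fintype ι] [DecidableEq ι] {κ : ι → Type*} [∀ i, Fintype (κ i)]
  [∀ i, DecidableEq (κ i)]

/-- Density matrices. -/
def IsDensityMatrix {n : Type*} [Fintype n] (ρ : Matrix n n ℂ) : Prop :=
  ρ.PosSemidef ∧ ρ.trace = 1

/-- The trace norm: the sum of the singular values, that is, of the square roots of the
eigenvalues of `Xᴴ X`. -/
def traceNorm {n : Type*} [Fintype n] [DecidableEq n] (X : Matrix n n ℂ) : ℝ :=
  ∑ k, √((Matrix.isHermitian_conjTranspose_mul_self X).eigenvalues k)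

/-- The partial trace over the `i`-th factor of `⊗ⱼ M_{κⱼ}(ℂ)`, the latter identified with the
matrices indexed by `∏ⱼ κⱼ`. -/
def partialTrace (i : ι) (X : Matrix (∀ j, κ j) (∀ j, κ j) ℂ) :
    Matrix (∀ j : {j // j ≠ i}, κ j) (∀ j : {j // j ≠ i}, κ j) ℂ :=
  Matrix.of fun k l => ∑ m : κ i,
    X ((Equiv.piSplitAt i κ).symm (m, k)) ((Equiv.piSplitAt i κ).symm (m, l))

/-- The Kronecker product `⊗ᵢ aᵢ` of a finite family of matrices. -/
def kron (a : ∀ i, CStarMatrix (κ i) (κ i) ℂ) : Matrix (∀ i, κ i) (∀ i, κ i) ℂ :=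
  Matrix.of fun k l => ∏ i, a i (k i) (l i)

/-- The quantum Wasserstein distance of order 1, in its form with trace norms:
`½ inf ∑ᵢ ‖Xᵢ‖₁` over decompositions `ρ - σ = ∑ᵢ Xᵢ` with `Xᵢ` Hermitian and `Trᵢ Xᵢ = 0`. -/
def wassersteinOne (ρ σ : Matrix (∀ i, κ i) (∀ i, κ i) ℂ) : ℝ≥0∞ :=
  ⨅ (X : ι → Matrix (∀ i, κ i) (∀ i, κ i) ℂ)
    (_ : (∀ i, (X i).IsHermitian ∧ partialTrace i (X i) = 0) ∧ ρ - σ = ∑ i, X i),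
    ENNReal.ofReal (1 / 2 * ∑ i, traceNorm (X i))

/-- The quantum Wasserstein distance of order 1, in its form with neighboring states:
`inf ∑ᵢ cᵢ` over decompositions `ρ - σ = ∑ᵢ cᵢ (ρᵢ - σᵢ)` with `cᵢ ≥ 0` and density matrices
`ρᵢ`, `σᵢ` such that `Trᵢ ρᵢ = Trᵢ σᵢ`. -/
def wassersteinOneNeighbor (ρ σ : Matrix (∀ i, κ i) (∀ i, κ i) ℂ) : ℝ≥0∞ :=
  ⨅ (c : ι → ℝ≥0) (R : ι → Matrix (∀ i, κ i) (∀ i, κ i) ℂ)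
    (S : ι → Matrix (∀ i, κ i) (∀ i, κ i) ℂ)
    (_ : (∀ i, IsDensityMatrix (R i) ∧ IsDensityMatrix (S i) ∧
        partialTrace i (R i) = partialTrace i (S i)) ∧
      ρ - σ = ∑ i, ((c i : ℝ) : ℂ) • (R i - S i)),
    ∑ i, (c i : ℝ≥0∞)

/-- The functional `μ` on `⊗ᵢ M_{κᵢ}(ℂ)` is given by the matrix `ρ`, that is,
`μ(⊗ aᵢ) = Tr (ρ ⊗ aᵢ)`. -/
def IsGivenBy {H : ι → Type*} [∀ i, NormedAddCommGroup (H i)] [∀ i, InnerProductSpace ℂ (H i)]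
    [∀ i, CompleteSpace (H i)]
    (π : ∀ i, CStarMatrix (κ i) (κ i) ℂ →⋆ₐ[ℂ] (H i →L[ℂ] H i))
    (μ : minTensor π →L[ℂ] ℂ) (ρ : Matrix (∀ i, κ i) (∀ i, κ i) ℂ) : Prop :=
  ∀ a : ∀ i, CStarMatrix (κ i) (κ i) ℂ, μ (elemTensor π a) = (ρ * kron a).trace

end Matrices

end QHamming

end

/-!
The slice of `a` by a vector state `⟪ξ, πᵢ(·) ξ⟫` of the `i`-th factor is a contraction of `A` onto
`Ãᵢ` that fixes `Ãᵢ`, so it moves `a` by at most `2 dist(a, Ãᵢ) = Lᵢ(a)`. Slicing all factors one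
after the other ends at a scalar, whence `dist(a, ℂ 1) ≤ ∑ᵢ Lᵢ(a)`; this makes the distance finite,
since `μ - ν` vanishes at `1`.

The condition `L_qH(a) ≤ 1` bounds the image of `a` in the sup-normed product of the quotients
`A / Ãᵢ`. The functional `μ - ν` is bounded on that image, and a Hahn–Banach extension to the whole
product splits it into functionals `φᵢ` on the quotients, with `∑ᵢ ‖φᵢ‖ᵢ` at most the norm of the
extension. Real parts do not increase these norms, so the `φᵢ` may be taken self-adjoint.

For matrix algebras, the functional `Tr (X ·)` has norm `‖X‖₁`, it vanishes on `Ãᵢ` if and only if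
`Trᵢ X = 0`, and then `‖Tr (X ·)‖ᵢ = ‖X‖₁ / 2`. The positive and negative parts of such an `X` have
equal partial traces, so their normalizations are neighbouring density matrices.
-/

noncomputable section

namespace QHamming

section SumOfFunctionals

open Metric

variable {𝕜 : Type*} [RCLike 𝕜]

theorem infDist_smul {E : Type*} [SeminormedAddCommGroup E] [NormedSpace 𝕜 E]
    (S : Submodule 𝕜 E) (c : 𝕜) (a : E) : infDist (c • a) S = ‖c‖ * infDist a S := by
  have infDist_eq_norm_mk (x : E) : infDist x S = ‖(Submodule.Quotient.mk x : E ⧸ S)‖ :=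
    (QuotientAddGroup.norm_mk (S := S.toAddSubgroup) x).symm
  rw [infDist_eq_norm_mk, infDist_eq_norm_mk, Submodule.Quotient.mk_smul, norm_smul]

theorem norm_apply_le_opNorm_mul_infDist {E F : Type*} [SeminormedAddCommGroup E]
    [NormedSpace 𝕜 E] [SeminormedAddCommGroup F] [NormedSpace 𝕜 F] {S : Submodule 𝕜 E}
    {φ : E →L[𝕜] F} (hφ : ∀ c ∈ S, φ c = 0) (a : E) : ‖φ a‖ ≤ ‖φ‖ * infDist a S := by
  rw [infDist_eq_iInf, Real.mul_iInf_of_nonneg (norm_nonneg φ)]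
  refine le_ciInf fun c => ?_
  rw [dist_eq_norm, ← sub_zero (φ a), ← hφ c c.2, ← map_sub]
  exact φ.le_opNorm _

theorem norm_le_mul_seminorm_of_unit {E : Type*} [AddCommGroup E] [Module 𝕜 E]
    {p : Seminorm 𝕜 E} {f : E →ₗ[𝕜] 𝕜} {D : ℝ} (h : ∀ a, p a ≤ 1 → ‖f a‖ ≤ D) (a : E) :
    ‖f a‖ ≤ D * p a := by
  have bound_of_lt {r : ℝ} (hr : p a < r) : ‖f a‖ ≤ D * r := by
    have hr₀ : 0 < r := (apply_nonneg p a).trans_lt hr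
    have norm_r : ‖(r : 𝕜)⁻¹‖ = r⁻¹ := by simp [abs_of_pos hr₀]
    have := h ((r : 𝕜)⁻¹ • a) (by
      rw [map_smul_eq_mul, norm_r, inv_mul_le_one₀ hr₀]
      exact hr.le)
    rwa [map_smul, norm_smul, norm_r, inv_mul_le_iff₀ hr₀, mul_comm] at this
  exact closure_minimal (s := Set.Ioi (p a)) (fun r hr => bound_of_lt hr)
    (isClosed_le continuous_const (continuous_const.mul continuous_id)) (by simp [closure_Ioi])

theorem opNorm_le_of_unit {E : Type*} [SeminormedAddCommGroup E] [NormedSpace 𝕜 E]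
    {f : StrongDual 𝕜 E} {D : ℝ} (h : ∀ a, ‖a‖ ≤ 1 → ‖f a‖ ≤ D) : ‖f‖ ≤ D :=
  f.opNorm_le_bound ((norm_nonneg _).trans (h 0 (by simp)))
    (norm_le_mul_seminorm_of_unit (p := normSeminorm 𝕜 E) (f := f.toLinearMap) h)

theorem exists_dual_comp_eq {E F : Type*} [AddCommGroup E] [Module 𝕜 E]
    [SeminormedAddCommGroup F] [NormedSpace 𝕜 F] (q : E →ₗ[𝕜] F) {f : E →ₗ[𝕜] 𝕜} {D : ℝ}
    (h : ∀ a, ‖q a‖ ≤ 1 → ‖f a‖ ≤ D) : ∃ g : StrongDual 𝕜 F, (∀ a, g (q a) = f a) ∧ ‖g‖ ≤ D := by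
  have hD : 0 ≤ D := (norm_nonneg _).trans (h 0 (by simp))
  have bound : ∀ a, ‖f a‖ ≤ D * ‖q a‖ :=
    norm_le_mul_seminorm_of_unit (p := (normSeminorm 𝕜 F).comp q) h
  obtain ⟨f', hf'⟩ : f ∈ LinearMap.range q.dualMap := by
    rw [LinearMap.range_dualMap_eq_dualAnnihilator_ker, Submodule.mem_dualAnnihilator]
    intro a ha
    simpa [LinearMap.mem_ker.mp ha] using bound a
  obtain ⟨g, hg, hg_norm⟩ := exists_extension_norm_eq (LinearMap.range q)
    ((f'.domRestrict (LinearMap.range q)).mkContinuous D (by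
      rintro ⟨_, a, rfl⟩
      simpa [← hf'] using bound a))
  refine ⟨g, fun a => ?_, hg_norm.trans_le (LinearMap.mkContinuous_norm_le _ hD _)⟩
  rw [← hf']
  exact hg ⟨q a, a, rfl⟩

theorem sum_opNorm_comp_single_le {ι : Type*} [Fintype ι] [DecidableEq ι] {E : ι → Type*}
    [∀ i, SeminormedAddCommGroup (E i)] [∀ i, NormedSpace 𝕜 (E i)]
    (g : StrongDual 𝕜 (∀ i, E i)) :
    ∑ i, ‖g.comp (ContinuousLinearMap.single 𝕜 E i)‖ ≤ ‖g‖ := by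
  let G : ∀ i, StrongDual 𝕜 (E i) := fun i => g.comp (ContinuousLinearMap.single 𝕜 E i)
  have hG i (z : E i) : G i z = g (Pi.single i z) := rfl
  change ∑ i, ‖G i‖ ≤ ‖g‖
  clear_value G
  suffices ∀ r : ι → ℝ, (∀ i, r i < ‖G i‖) → ∑ i, r i ≤ ‖g‖ by
    have mem : (fun i => ‖G i‖) ∈ closure (Set.univ.pi fun i => Set.Iio ‖G i‖) := by
      simp [closure_pi_set]
    have closed : IsClosed {r : ι → ℝ | ∑ i, r i ≤ ‖g‖} :=
      isClosed_le (by fun_prop) continuous_const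
    exact closure_minimal (s := Set.univ.pi fun i => Set.Iio ‖G i‖)
      (fun r hr => this r fun i => Set.mem_Iio.1 (hr i trivial))
      closed mem
  intro r hr
  have nearly_attained i : ∃ x : E i, ‖x‖ ≤ 1 ∧ r i < ‖G i x‖ := by
    by_contra! h
    exact (hr i).not_ge (opNorm_le_of_unit h)
  choose x hx hrx using nearly_attained
  choose c hc hcx using fun i => RCLike.exists_norm_eq_mul_self (G i (x i))
  let y : ∀ i, E i := fun i => c i • x i
  have hy : ‖y‖ ≤ 1 := (pi_norm_le_iff_of_nonneg zero_le_one).2 fun i => by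
    simpa [y, norm_smul, hc] using hx i
  have hgy : g y = ((∑ i, ‖G i (x i)‖ : ℝ) : 𝕜) := calc
    g y = ∑ i, G i (y i) := by simp only [hG, ← map_sum, Finset.univ_sum_single]
    _ = ((∑ i, ‖G i (x i)‖ : ℝ) : 𝕜) := by
      simp only [y, map_smul, RCLike.ofReal_sum, hcx, smul_eq_mul]
  calc ∑ i, r i ≤ ∑ i, ‖G i (x i)‖ := Finset.sum_le_sum fun i _ => (hrx i).le
    _ = ‖g y‖ := by rw [hgy, RCLike.norm_ofReal, abs_of_nonneg (by positivity)]
    _ ≤ ‖g‖ * 1 := g.le_opNorm_of_le hy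
    _ = ‖g‖ := mul_one _

theorem exists_eq_sum_of_forall_infDist_le_one {ι E : Type*} [Fintype ι] [SeminormedAddCommGroup E]
    [NormedSpace 𝕜 E] (S : ι → Submodule 𝕜 E) {f : StrongDual 𝕜 E} {D : ℝ}
    (h : ∀ a, (∀ i, infDist a (S i) ≤ 1) → ‖f a‖ ≤ D) :
    ∃ φ : ι → StrongDual 𝕜 E, (∀ i, ∀ c ∈ S i, φ i c = 0) ∧ f = ∑ i, φ i ∧ ∑ i, ‖φ i‖ ≤ D := by
  classical
  have norm_mkQ i (a : E) : ‖(S i).mkQ a‖ = infDist a (S i) :=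
    QuotientAddGroup.norm_mk (S := (S i).toAddSubgroup) a
  obtain ⟨g, hg, hgD⟩ := exists_dual_comp_eq (LinearMap.pi fun i => (S i).mkQ) (f := f.toLinearMap)
    (D := D) fun a ha => h a fun i => by
      rw [← norm_mkQ]
      exact (norm_le_pi_norm (LinearMap.pi (fun i => (S i).mkQ) a) i).trans ha
  let G i := g.comp (ContinuousLinearMap.single 𝕜 (fun i => E ⧸ S i) i)
  have norm_mk_le i (a : E) : ‖G i ((S i).mkQ a)‖ ≤ ‖G i‖ * ‖a‖ :=
    (G i).le_opNorm_of_le (Submodule.Quotient.norm_mk_le _ _)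
  refine ⟨fun i => ((G i).toLinearMap ∘ₗ (S i).mkQ).mkContinuous ‖G i‖ (norm_mk_le i),
    fun i c hc => ?_, ?_, ?_⟩
  · simp [(Submodule.Quotient.mk_eq_zero _).2 hc]
  · ext a
    have := hg a
    rw [← Finset.univ_sum_single (LinearMap.pi (fun i => (S i).mkQ) a), map_sum] at this
    rw [sum_apply]
    exact this.symm
  · exact (Finset.sum_le_sum fun i _ => LinearMap.mkContinuous_norm_le _ (norm_nonneg _) _).trans
      ((sum_opNorm_comp_single_le g).trans hgD)

end SumOfFunctionals

theorem adjoin_toSubmodule_eq_span {R B : Type*} [CommSemiring R] [StarRing R] [Semiring B]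
    [StarRing B] [Algebra R B] [StarModule R B] {M : Submonoid B} (hM : ∀ x ∈ M, star x ∈ M) :
    (StarAlgebra.adjoin R (M : Set B)).toSubalgebra.toSubmodule = Submodule.span R M := by
  have star_subset : star (M : Set B) ⊆ M := fun x hx => star_star x ▸ hM _ hx
  rw [StarAlgebra.adjoin_toSubalgebra, Set.union_eq_self_of_subset_right star_subset,
    Algebra.adjoin_eq_span, Submonoid.closure_eq]

section OperatorTensor

variable {ι : Type*} [Fintype ι] {H : ι → Type*} [∀ i, NormedAddCommGroup (H i)]
  [∀ i, InnerProductSpace ℂ (H i)]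

/-- The elementary tensor `⊗ ξᵢ` as a multilinear function of the vectors `ξᵢ`. -/
def vecTensorMultilinear : MultilinearMap ℂ H (HilbertTensor H) where
  toFun := vecTensor
  map_update_add' ξ i a b := by
    simp only [vecTensor, ← UniformSpace.Completion.coe_add]
    exact congrArg _ ((PiTensorProduct.tprod ℂ).map_update_add ξ i a b)
  map_update_smul' ξ i c a := by
    simp only [vecTensor, ← UniformSpace.Completion.coe_smul]
    exact congrArg _ ((PiTensorProduct.tprod ℂ).map_update_smul ξ i c a)

theorem dense_span_range_vecTensor :
    Dense (Submodule.span ℂ (Set.range (vecTensor (H := H))) : Set (HilbertTensor H)) := by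
  refine UniformSpace.Completion.denseRange_coe.mono (Set.range_subset_iff.2 fun x => ?_)
  obtain ⟨n, c, v, rfl⟩ := exists_sum x
  rw [← UniformSpace.Completion.coe_toComplL (𝕜 := ℂ), map_sum]
  refine Submodule.sum_mem _ fun k _ => ?_
  rw [map_smul]
  exact Submodule.smul_mem _ _ (Submodule.subset_span ⟨v k, rfl⟩)

theorem clm_ext_vecTensor {F : Type*} [AddCommMonoid F] [Module ℂ F] [TopologicalSpace F]
    [T2Space F] {S T : HilbertTensor H →L[ℂ] F} (h : ∀ ξ, S (vecTensor ξ) = T (vecTensor ξ)) :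
    S = T :=
  ContinuousLinearMap.ext_on dense_span_range_vecTensor (Set.forall_mem_range.2 h)

theorem ext_inner_vecTensor {x y : HilbertTensor H}
    (h : ∀ ξ, inner ℂ x (vecTensor ξ) = inner ℂ y (vecTensor ξ)) : x = y :=
  (innerSL_inj (𝕜 := ℂ)).1 (clm_ext_vecTensor h)

theorem opTensor_mul (S T : ∀ i, H i →L[ℂ] H i) : opTensor (S * T) = opTensor S * opTensor T :=
  clm_ext_vecTensor fun ξ => by simp [opTensor_vecTensor]

theorem opTensor_one : opTensor (1 : ∀ i, H i →L[ℂ] H i) = 1 :=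
  clm_ext_vecTensor fun ξ => by simp [opTensor_vecTensor]

theorem opTensor_star [∀ i, CompleteSpace (H i)] (T : ∀ i, H i →L[ℂ] H i) :
    opTensor (star T) = star (opTensor T) := by
  refine clm_ext_vecTensor fun ξ => ext_inner_vecTensor fun η => ?_
  simp [ContinuousLinearMap.star_eq_adjoint, ContinuousLinearMap.adjoint_inner_left,
    opTensor_vecTensor, inner_vecTensor]

/-- The operator `⊗ Tᵢ` as a multilinear function of the operators `Tᵢ`. -/
def opTensorMultilinear :
    MultilinearMap ℂ (fun i => H i →L[ℂ] H i) (HilbertTensor H →L[ℂ] HilbertTensor H) where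
  toFun := opTensor
  map_update_add' T i S S' := clm_ext_vecTensor fun ξ => by
    simp only [opTensor_vecTensor, add_apply,
      Function.apply_update (fun j (T : H j →L[ℂ] H j) => T (ξ j))]
    exact vecTensorMultilinear.map_update_add (fun j => T j (ξ j)) i (S (ξ i)) (S' (ξ i))
  map_update_smul' T i c S := clm_ext_vecTensor fun ξ => by
    simp only [opTensor_vecTensor, smul_apply,
      Function.apply_update (fun j (T : H j →L[ℂ] H j) => T (ξ j))]
    exact vecTensorMultilinear.map_update_smul (fun j => T j (ξ j)) i c (S (ξ i))

theorem nontrivial_hilbertTensor [∀ i, Nontrivial (H i)] : Nontrivial (HilbertTensor H) := by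
  choose ξ hξ using fun i => exists_ne (0 : H i)
  refine ⟨vecTensor ξ, 0, fun h => ?_⟩
  have prod_inner_eq_zero := inner_vecTensor ξ ξ
  rw [h, inner_zero_left, eq_comm, Finset.prod_eq_zero_iff] at prod_inner_eq_zero
  obtain ⟨i, -, hi⟩ := prod_inner_eq_zero
  exact hξ i (inner_self_eq_zero.mp hi)

variable [DecidableEq ι] [∀ i, CompleteSpace (H i)]

/-- The operator `1 ⊗ ⋯ ⊗ T ⊗ ⋯ ⊗ 1` acting as `T` on the `i`-th factor, as a function of `T`. -/
def ampliation (i : ι) :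
    (H i →L[ℂ] H i) →⋆ₐ[ℂ] (HilbertTensor H →L[ℂ] HilbertTensor H) where
  toFun T := opTensor (Pi.mulSingle i T)
  map_one' := by rw [Pi.mulSingle_one, opTensor_one]
  map_mul' S T := by rw [Pi.mulSingle_mul, opTensor_mul]
  map_zero' := (opTensorMultilinear.toLinearMap 1 i).map_zero
  map_add' := (opTensorMultilinear.toLinearMap 1 i).map_add
  commutes' c := by
    rw [Algebra.algebraMap_eq_smul_one, Algebra.algebraMap_eq_smul_one, ← opTensor_one,
      ← Pi.mulSingle_one i]
    exact (opTensorMultilinear.toLinearMap 1 i).map_smul c 1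
  map_star' T := by rw [← opTensor_star, Pi.star_mulSingle]

theorem ampliation_mul_opTensor (i : ι) (S : H i →L[ℂ] H i) (T : ∀ i, H i →L[ℂ] H i) :
    ampliation i S * opTensor T = opTensor (Function.update T i (S * T i)) := by
  change opTensor _ * _ = _
  rw [← opTensor_mul, Pi.mulSingle, ← Function.update_eq_self i T, ← Function.update_mul]
  simp

theorem opTensor_mul_ampliation (i : ι) (S : H i →L[ℂ] H i) (T : ∀ i, H i →L[ℂ] H i) :
    opTensor T * ampliation i S = opTensor (Function.update T i (T i * S)) := by
  change _ * opTensor _ = _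
  rw [← opTensor_mul, Pi.mulSingle, ← Function.update_eq_self i T, ← Function.update_mul]
  simp

theorem ampliation_vecTensor (i : ι) (T : H i →L[ℂ] H i) (ξ : ∀ i, H i) :
    ampliation i T (vecTensor ξ) = vecTensor (Function.update ξ i (T (ξ i))) := by
  change opTensor _ _ = _
  simp only [opTensor_vecTensor, Pi.mulSingle,
    Function.apply_update (fun j (T : H j →L[ℂ] H j) => T (ξ j))]
  rfl

end OperatorTensor

section CompressionBound

open InnerProductSpace

variable {ι : Type*} [Fintype ι] [DecidableEq ι] {H : ι → Type*} [∀ i, NormedAddCommGroup (H i)]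
  [∀ i, InnerProductSpace ℂ (H i)] [∀ i, CompleteSpace (H i)] {i : ι}

theorem exists_ampliation_sum_rankOne_apply_eq (i : ι) {y : HilbertTensor H}
    (hy : y ∈ Submodule.span ℂ (Set.range vecTensor)) :
    ∃ (m : ℕ) (e : Fin m → H i), ampliation i (∑ l, rankOne ℂ (e l) (e l)) y = y := by
  obtain ⟨n, c, v, rfl⟩ := Submodule.mem_span_set'.1 hy
  choose ξ hξ using fun k => (v k).2
  let F := Submodule.span ℂ (Set.range fun k => ξ k i)
  have : FiniteDimensional ℂ F := FiniteDimensional.span_of_finite ℂ (Set.finite_range _)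
  let b := stdOrthonormalBasis ℂ F
  have fixed k : (∑ l, rankOne ℂ (b l : H i) (b l : H i)) (ξ k i) = ξ k i := by
    simpa using congrArg Subtype.val (b.sum_repr' ⟨ξ k i, Submodule.subset_span ⟨k, rfl⟩⟩)
  refine ⟨_, fun l => b l, ?_⟩
  rw [map_sum]
  refine Finset.sum_congr rfl fun k _ => ?_
  rw [map_smul, ← hξ, ampliation_vecTensor, fixed, Function.update_eq_self]

theorem sum_norm_sq_ampliation_rankOne {n : Type*} [Fintype n] {ξ : H i} (hξ : ‖ξ‖ = 1)
    (e : n → H i) (x : HilbertTensor H) :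
    ∑ l, ‖ampliation i (rankOne ℂ ξ (e l)) x‖ ^ 2 =
      (inner ℂ x (ampliation i (∑ l, rankOne ℂ (e l) (e l)) x)).re := by
  have star_mul_self l :
      star (rankOne ℂ ξ (e l)) * rankOne ℂ ξ (e l) = rankOne ℂ (e l) (e l) := by
    rw [ContinuousLinearMap.star_eq_adjoint, adjoint_rankOne, ContinuousLinearMap.mul_def,
      rankOne_comp_rankOne]
    simp [hξ]
  rw [map_sum, sum_apply, inner_sum, Complex.re_sum]
  refine Finset.sum_congr rfl fun l _ => ?_
  rw [← star_mul_self, map_mul, map_star, ContinuousLinearMap.star_eq_adjoint,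
    mul_apply_eq_comp, ContinuousLinearMap.adjoint_inner_right]
  exact norm_sq_eq_re_inner (𝕜 := ℂ) _

-- `D` is the slice of `C` by the vector state of `ξ`. With `e` running through an orthonormal basis
-- of `H i`, Parseval turns the relation `h` into a bound on `‖D y‖`.
theorem norm_le_of_ampliation_rankOne_mul {ξ : H i} (hξ : ‖ξ‖ = 1)
    {C D : HilbertTensor H →L[ℂ] HilbertTensor H} (hcomm : ∀ T, Commute (ampliation i T) D)
    (h : ∀ e, ampliation i (rankOne ℂ ξ e) * D =
      ampliation i (rankOne ℂ ξ ξ) * C * ampliation i (rankOne ℂ ξ e)) : ‖D‖ ≤ ‖C‖ := by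
  have compress_le e y : ‖ampliation i (rankOne ℂ ξ e) (D y)‖ ≤
      ‖C‖ * ‖ampliation i (rankOne ℂ ξ e) y‖ := by
    have norm_proj : ‖ampliation i (rankOne ℂ ξ ξ)‖ ≤ 1 :=
      (NonUnitalStarAlgHom.norm_apply_le (ampliation (H := H) i) _).trans (by simp [hξ])
    calc ‖ampliation i (rankOne ℂ ξ e) (D y)‖
        = ‖(ampliation i (rankOne ℂ ξ ξ) * C) (ampliation i (rankOne ℂ ξ e) y)‖ :=
          congrArg norm (DFunLike.congr_fun (h e) y)
      _ ≤ ‖C‖ * ‖ampliation i (rankOne ℂ ξ e) y‖ := by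
        refine ContinuousLinearMap.le_of_opNorm_le _ ((norm_mul_le _ _).trans ?_) _
        exact mul_le_of_le_one_left (norm_nonneg C) norm_proj
  have bound (y) (hy : y ∈ Submodule.span ℂ (Set.range vecTensor)) : ‖D y‖ ≤ ‖C‖ * ‖y‖ := by
    obtain ⟨m, e, he⟩ := exists_ampliation_sum_rankOne_apply_eq i hy
    have heD : ampliation i (∑ l, rankOne ℂ (e l) (e l)) (D y) = D y := by
      rw [← mul_apply_eq_comp, (hcomm _).eq, mul_apply_eq_comp, he]
    have sq_eq {z : HilbertTensor H} (hz : ampliation i (∑ l, rankOne ℂ (e l) (e l)) z = z) :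
        ‖z‖ ^ 2 = ∑ l, ‖ampliation i (rankOne ℂ ξ (e l)) z‖ ^ 2 := by
      rw [sum_norm_sq_ampliation_rankOne hξ, hz]
      exact norm_sq_eq_re_inner (𝕜 := ℂ) z
    rw [← sq_le_sq₀ (norm_nonneg _) (by positivity), mul_pow, sq_eq he, sq_eq heD, Finset.mul_sum]
    refine Finset.sum_le_sum fun l _ => ?_
    rw [← mul_pow]
    exact pow_le_pow_left₀ (norm_nonneg _) (compress_le _ _) 2
  have closed : IsClosed {y | ‖D y‖ ≤ ‖C‖ * ‖y‖} := isClosed_le (by fun_prop) (by fun_prop)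
  exact D.opNorm_le_bound (norm_nonneg C) fun y =>
    closure_minimal bound closed (dense_span_range_vecTensor y)

end CompressionBound

section ElementaryTensors

variable {ι : Type*} [Fintype ι] {A : ι → Type*} [∀ i, CStarAlgebra (A i)]
  {H : ι → Type*} [∀ i, NormedAddCommGroup (H i)] [∀ i, InnerProductSpace ℂ (H i)]
  [∀ i, CompleteSpace (H i)] (π : ∀ i, A i →⋆ₐ[ℂ] (H i →L[ℂ] H i))

theorem isClosed_minTensor :
    IsClosed (minTensor π : Set (HilbertTensor H →L[ℂ] HilbertTensor H)) :=
  StarSubalgebra.isClosed_topologicalClosure _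

instance : CompleteSpace (minTensor π) :=
  (isClosed_minTensor π).completeSpace_coe

theorem coe_elemTensor (a : ∀ i, A i) :
    (elemTensor π a : HilbertTensor H →L[ℂ] HilbertTensor H) = opTensor fun i => π i (a i) :=
  rfl

theorem elemTensor_one : elemTensor π 1 = 1 :=
  Subtype.ext (by simpa [coe_elemTensor] using! opTensor_one)

theorem elemTensor_mul (a b : ∀ i, A i) :
    elemTensor π (a * b) = elemTensor π a * elemTensor π b :=
  Subtype.ext (by simpa [coe_elemTensor] using! opTensor_mul _ _)

theorem elemTensor_star (a : ∀ i, A i) : elemTensor π (star a) = star (elemTensor π a) :=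
  Subtype.ext (by simpa [coe_elemTensor, map_star] using! opTensor_star _)

/-- The elementary tensor `⊗ aᵢ` as a multilinear function of the `aᵢ`. -/
def elemTensorMultilinear : MultilinearMap ℂ A (minTensor π) where
  toFun := elemTensor π
  map_update_add' a i x y := Subtype.ext ((opTensorMultilinear.compLinearMap
    fun i => (π i).toAlgHom.toLinearMap).map_update_add a i x y)
  map_update_smul' a i c x := Subtype.ext ((opTensorMultilinear.compLinearMap
    fun i => (π i).toAlgHom.toLinearMap).map_update_smul a i c x)

/-- The canonical map from the algebraic to the minimal tensor product. -/
def ofTensor : PiTensorProduct ℂ A →ₗ[ℂ] minTensor π :=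
  PiTensorProduct.lift (elemTensorMultilinear π)

theorem ofTensor_tprod (a : ∀ i, A i) :
    ofTensor π (PiTensorProduct.tprod ℂ a) = elemTensor π a :=
  PiTensorProduct.lift.tprod a

/-- The elementary tensors whose factors with index in `s` are equal to `1`. -/
def elemTensorsOneOn (s : Finset ι) : Submonoid (minTensor π) where
  carrier := {x | ∃ a : ∀ j, A j, (∀ i ∈ s, a i = 1) ∧ x = elemTensor π a}
  one_mem' := ⟨1, by simp, (elemTensor_one π).symm⟩
  mul_mem' := by
    rintro _ _ ⟨a, ha, rfl⟩ ⟨b, hb, rfl⟩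
    exact ⟨a * b, fun i hi => by simp [ha i hi, hb i hi], (elemTensor_mul π a b).symm⟩

theorem star_mem_elemTensorsOneOn {s : Finset ι} :
    ∀ x ∈ elemTensorsOneOn π s, star x ∈ elemTensorsOneOn π s := by
  rintro _ ⟨a, ha, rfl⟩
  exact ⟨star a, fun i hi => by simp [ha i hi], (elemTensor_star π a).symm⟩

/-- The subspace `⊗_{j ∉ s} Aⱼ` of `⊗ⱼ Aⱼ`, closed but regarded only as a linear subspace. -/
def subTensor (s : Finset ι) : Submodule ℂ (minTensor π) :=
  (Submodule.span ℂ (elemTensorsOneOn π s)).topologicalClosure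

theorem elemTensor_mem_subTensor {s : Finset ι} {a : ∀ i, A i} (ha : ∀ i ∈ s, a i = 1) :
    elemTensor π a ∈ subTensor π s :=
  Submodule.le_topologicalClosure _ (Submodule.subset_span ⟨a, ha, rfl⟩)

variable {π} in
theorem subTensor_le {s : Finset ι} {S : Submodule ℂ (minTensor π)}
    (hS : IsClosed (S : Set (minTensor π)))
    (h : ∀ a : ∀ i, A i, (∀ i ∈ s, a i = 1) → elemTensor π a ∈ S) : subTensor π s ≤ S := by
  refine Submodule.topologicalClosure_minimal _ (Submodule.span_le.2 ?_) hS
  rintro _ ⟨a, ha, rfl⟩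
  exact h a ha

theorem tilde_toSubmodule (i : ι) :
    (tilde π i).toSubalgebra.toSubmodule = subTensor π {i} := by
  have generators : {x | ∃ a : ∀ j, A j, a i = 1 ∧ x = elemTensor π a} =
      elemTensorsOneOn π {i} := by
    simp [elemTensorsOneOn]
  rw [subTensor, ← adjoin_toSubmodule_eq_span (star_mem_elemTensorsOneOn π), ← generators]
  exact SetLike.coe_injective rfl

theorem mem_tilde_iff {i : ι} {c : minTensor π} : c ∈ tilde π i ↔ c ∈ subTensor π {i} := by
  rw [← tilde_toSubmodule]
  rfl

theorem eq_zero_on_tilde_iff (i : ι) (φ : minTensor π →L[ℂ] ℂ) :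
    (∀ c ∈ tilde π i, φ c = 0) ↔ ∀ a : ∀ j, A j, a i = 1 → φ (elemTensor π a) = 0 := by
  simp only [mem_tilde_iff]
  refine ⟨fun h a ha => h _ (elemTensor_mem_subTensor π (by simpa using ha)), fun h => ?_⟩
  exact subTensor_le (S := LinearMap.ker φ.toLinearMap) φ.isClosed_ker
    fun a ha => h a (ha i (Finset.mem_singleton_self i))

theorem dense_span_range_elemTensor :
    Dense (Submodule.span ℂ (Set.range (elemTensor π)) : Set (minTensor π)) := by
  let R : Submonoid (HilbertTensor H →L[ℂ] HilbertTensor H) :=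
    { carrier := Set.range fun a : ∀ i, A i => opTensor fun i => π i (a i)
      one_mem' := ⟨1, congrArg Subtype.val (elemTensor_one π)⟩
      mul_mem' := by
        rintro _ _ ⟨a, rfl⟩ ⟨b, rfl⟩
        exact ⟨a * b, congrArg Subtype.val (elemTensor_mul π a b)⟩ }
  have star_mem : ∀ x ∈ R, star x ∈ R := by
    rintro _ ⟨a, rfl⟩
    exact ⟨star a, congrArg Subtype.val (elemTensor_star π a)⟩
  have span_eq : Submodule.span ℂ (R : Set (HilbertTensor H →L[ℂ] HilbertTensor H)) =
      (Submodule.span ℂ (Set.range (elemTensor π))).map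
        (minTensor π).toSubalgebra.toSubmodule.subtype := by
    rw [Submodule.map_span, ← Set.range_comp]
    rfl
  rw [Topology.IsInducing.subtypeVal.dense_iff]
  intro x
  have hx : (x : HilbertTensor H →L[ℂ] HilbertTensor H) ∈ closure (StarAlgebra.adjoin ℂ
    (R : Set (HilbertTensor H →L[ℂ] HilbertTensor H)) : Set _) := x.2
  rwa [← StarSubalgebra.coe_toSubalgebra, ← Subalgebra.coe_toSubmodule,
    adjoin_toSubmodule_eq_span star_mem, span_eq] at hx

theorem subTensor_empty : subTensor π ∅ = ⊤ := by
  refine eq_top_iff.2 fun x _ => ?_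
  have generators : (elemTensorsOneOn π ∅ : Set (minTensor π)) = Set.range (elemTensor π) := by
    simp [elemTensorsOneOn, Set.range, eq_comm]
  change x ∈ closure (Submodule.span ℂ (elemTensorsOneOn π ∅ : Set (minTensor π)) : Set _)
  rw [generators]
  exact dense_span_range_elemTensor π x

theorem subTensor_univ_le : subTensor π Finset.univ ≤ Submodule.span ℂ {1} := by
  refine subTensor_le (Submodule.closed_of_finiteDimensional _) fun a ha => ?_
  rw [show a = 1 from funext fun i => ha i (Finset.mem_univ i), elemTensor_one]
  exact Submodule.mem_span_singleton_self 1

theorem range_ofTensor :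
    LinearMap.range (ofTensor π) = Submodule.span ℂ (Set.range (elemTensor π)) := by
  rw [LinearMap.range_eq_map, ← PiTensorProduct.span_tprod_eq_top, Submodule.map_span,
    ← Set.range_comp]
  exact congrArg _ (congrArg _ (funext (ofTensor_tprod π)))

theorem denseRange_ofTensor : DenseRange (ofTensor π) := by
  have := dense_span_range_elemTensor π
  rwa [← range_ofTensor, LinearMap.coe_range] at this

theorem clm_ext_elemTensor {F : Type*} [AddCommMonoid F] [Module ℂ F] [TopologicalSpace F]
    [T2Space F] {S T : minTensor π →L[ℂ] F} (h : ∀ a, S (elemTensor π a) = T (elemTensor π a)) :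
    S = T :=
  ContinuousLinearMap.ext_on (dense_span_range_elemTensor π) (Set.forall_mem_range.2 h)

theorem nontrivial_factor [Nontrivial (minTensor π)] (i : ι) : Nontrivial (H i) := by
  by_contra h
  rw [not_nontrivial_iff_subsingleton] at h
  have vecTensor_eq_zero (ξ : ∀ i, H i) : vecTensor ξ = 0 := by
    rw [← inner_self_eq_zero (𝕜 := ℂ), inner_vecTensor]
    refine Finset.prod_eq_zero (Finset.mem_univ i) ?_
    rw [Subsingleton.elim (ξ i) 0, inner_zero_left]
  refine zero_ne_one (α := minTensor π) (Subtype.ext (clm_ext_vecTensor fun ξ => ?_))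
  rw [vecTensor_eq_zero, map_zero, map_zero]

end ElementaryTensors

section SliceMaps

open InnerProductSpace

variable {ι : Type*} [Fintype ι] [DecidableEq ι] {A : ι → Type*} [∀ i, CStarAlgebra (A i)]
  {H : ι → Type*} [∀ i, NormedAddCommGroup (H i)] [∀ i, InnerProductSpace ℂ (H i)]
  [∀ i, CompleteSpace (H i)] (π : ∀ i, A i →⋆ₐ[ℂ] (H i →L[ℂ] H i)) {i : ι} {ξ : H i}

/-- The map `⊗ aⱼ ↦ ⟪ξ, πᵢ(aᵢ) ξ⟫ ⊗_{j ≠ i} aⱼ` on the algebraic tensor product; `ofTensorSlice`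
is its value in the minimal tensor product. -/
def ofTensorSlice (i : ι) (ξ : H i) : PiTensorProduct ℂ A →ₗ[ℂ] minTensor π :=
  PiTensorProduct.lift ((elemTensorMultilinear π).compLinearMap
    (Function.update (fun _ => LinearMap.id) i
      (((innerSL ℂ ξ).toLinearMap ∘ₗ (ContinuousLinearMap.apply ℂ (H i) ξ).toLinearMap ∘ₗ
        (π i).toAlgHom.toLinearMap).smulRight 1)))

theorem ofTensorSlice_tprod (a : ∀ i, A i) :
    ofTensorSlice π i ξ (PiTensorProduct.tprod ℂ a) =
      inner ℂ ξ (π i (a i) ξ) • elemTensor π (Function.update a i 1) := by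
  refine (PiTensorProduct.lift.tprod a).trans (Eq.trans ?_
    ((elemTensorMultilinear π).map_update_smul a i (inner ℂ ξ (π i (a i) ξ)) 1))
  change elemTensor π _ = elemTensor π _
  congr 1
  funext j
  obtain rfl | hj := eq_or_ne j i
  · simp
  · simp [hj]

theorem commute_ampliation_ofTensorSlice (T : H i →L[ℂ] H i) (t : PiTensorProduct ℂ A) :
    Commute (ampliation i T) (ofTensorSlice π i ξ t : HilbertTensor H →L[ℂ] HilbertTensor H) := by
  induction t using PiTensorProduct.induction_on with
  | smul_tprod r a =>
    rw [map_smul, ofTensorSlice_tprod]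
    refine (Commute.smul_right ?_ _).smul_right r
    rw [Commute, SemiconjBy, coe_elemTensor, ampliation_mul_opTensor, opTensor_mul_ampliation]
    simp
  | add x y hx hy =>
    rw [map_add]
    exact hx.add_right hy

theorem ampliation_rankOne_mul_ofTensorSlice (e : H i) (t : PiTensorProduct ℂ A) :
    ampliation i (rankOne ℂ ξ e) * (ofTensorSlice π i ξ t : HilbertTensor H →L[ℂ] HilbertTensor H) =
      ampliation i (rankOne ℂ ξ ξ) * ofTensor π t * ampliation i (rankOne ℂ ξ e) := by
  induction t using PiTensorProduct.induction_on with
  | smul_tprod r a =>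
    have compress : rankOne ℂ ξ ξ * π i (a i) * rankOne ℂ ξ e =
        inner ℂ ξ (π i (a i) ξ) • rankOne ℂ ξ e := by
      ext x
      simp [rankOne_apply, smul_smul, mul_comm]
    have := opTensorMultilinear.map_update_smul (fun j => π j (a j)) i
      (inner ℂ ξ (π i (a i) ξ)) (rankOne ℂ ξ e)
    rw [map_smul, map_smul, ofTensorSlice_tprod, ofTensor_tprod]
    push_cast
    rw [mul_smul_comm, mul_smul_comm, mul_smul_comm, smul_mul_assoc, coe_elemTensor,
      coe_elemTensor, ampliation_mul_opTensor, ampliation_mul_opTensor, opTensor_mul_ampliation]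
    simp only [Function.update_self, Function.update_idem, compress, map_one,
      Function.apply_update (fun j (x : A j) => π j x), mul_one]
    exact congrArg (r • ·) this.symm
  | add x y hx hy => simp only [map_add, AddMemClass.coe_add, mul_add, add_mul, hx, hy]

variable (hξ : ‖ξ‖ = 1)
include hξ

theorem norm_ofTensorSlice_le (t : PiTensorProduct ℂ A) :
    ‖ofTensorSlice π i ξ t‖ ≤ ‖ofTensor π t‖ :=
  norm_le_of_ampliation_rankOne_mul hξ (commute_ampliation_ofTensorSlice π · t)
    (ampliation_rankOne_mul_ofTensorSlice π · t)

/-- The slice map `⊗ aⱼ ↦ ⟪ξ, πᵢ(aᵢ) ξ⟫ ⊗_{j ≠ i} aⱼ`, for a unit vector `ξ`. -/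
def slice (i : ι) (ξ : H i) : minTensor π →L[ℂ] minTensor π :=
  (ofTensorSlice π i ξ).extendOfNorm (ofTensor π)

theorem slice_ofTensor (t : PiTensorProduct ℂ A) :
    slice π i ξ (ofTensor π t) = ofTensorSlice π i ξ t :=
  LinearMap.extendOfNorm_eq (denseRange_ofTensor π)
    ⟨1, fun t => by simpa using norm_ofTensorSlice_le π hξ t⟩ t

theorem slice_elemTensor (a : ∀ i, A i) :
    slice π i ξ (elemTensor π a) =
      inner ℂ ξ (π i (a i) ξ) • elemTensor π (Function.update a i 1) := by
  rw [← ofTensor_tprod, slice_ofTensor π hξ, ofTensorSlice_tprod]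

theorem norm_slice_le : ‖slice π i ξ‖ ≤ 1 :=
  LinearMap.opNorm_extendOfNorm_le (denseRange_ofTensor π) zero_le_one
    fun t => by simpa using norm_ofTensorSlice_le π hξ t

theorem slice_mem_subTensor_insert {s : Finset ι} {b : minTensor π} (hb : b ∈ subTensor π s) :
    slice π i ξ b ∈ subTensor π (insert i s) := by
  refine subTensor_le (S := (subTensor π (insert i s)).comap (slice π i ξ).toLinearMap)
    ((Submodule.isClosed_topologicalClosure _).preimage (slice π i ξ).continuous)
    (fun a ha => ?_) hb
  change slice π i ξ (elemTensor π a) ∈ subTensor π (insert i s)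
  rw [slice_elemTensor π hξ]
  refine Submodule.smul_mem _ _ (elemTensor_mem_subTensor π fun j hj => ?_)
  obtain rfl | hji := eq_or_ne j i
  · simp
  · simpa [hji] using ha j (Finset.mem_of_mem_insert_of_ne hj hji)

theorem slice_eq_self {c : minTensor π} (hc : c ∈ subTensor π {i}) : slice π i ξ c = c := by
  refine sub_eq_zero.1 (subTensor_le (S := LinearMap.ker (slice π i ξ - 1).toLinearMap)
    (slice π i ξ - 1).isClosed_ker (fun a ha => ?_) hc)
  have hai := ha i (Finset.mem_singleton_self i)
  change slice π i ξ (elemTensor π a) - elemTensor π a = 0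
  rw [slice_elemTensor π hξ, hai, ← hai, Function.update_eq_self, hai, map_one]
  simp [inner_self_eq_norm_sq_to_K, hξ]

theorem norm_sub_slice_le (a : minTensor π) :
    ‖a - slice π i ξ a‖ ≤ 2 * Metric.infDist a (subTensor π {i}) := by
  have vanish : ∀ c ∈ subTensor π {i}, (1 - slice π i ξ) c = 0 := fun c hc => by
    simp [slice_eq_self π hξ hc]
  have norm_le_two : ‖1 - slice π i ξ‖ ≤ 2 :=
    ContinuousLinearMap.opNorm_le_bound _ zero_le_two fun x =>
      calc ‖x - slice π i ξ x‖ ≤ ‖x‖ + ‖slice π i ξ x‖ := norm_sub_le _ _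
        _ ≤ ‖x‖ + 1 * ‖x‖ := by
          gcongr
          exact ContinuousLinearMap.le_of_opNorm_le _ (norm_slice_le π hξ) x
        _ = 2 * ‖x‖ := by ring
  exact (norm_apply_le_opNorm_mul_infDist vanish a).trans
    (mul_le_mul_of_nonneg_right norm_le_two Metric.infDist_nonneg)

omit hξ

omit [DecidableEq ι] in
theorem exists_mem_subTensor_norm_sub_le [∀ i, Nontrivial (H i)] (a : minTensor π)
    (s : Finset ι) :
    ∃ b ∈ subTensor π s, ‖a - b‖ ≤ ∑ i ∈ s, 2 * Metric.infDist a (subTensor π {i}) := by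
  classical
  induction s using Finset.induction_on with
  | empty => exact ⟨a, by simp [subTensor_empty], by simp⟩
  | insert i s hi ih =>
    obtain ⟨b, hb, hab⟩ := ih
    obtain ⟨ξ, hξ⟩ := exists_norm_eq (H i) zero_le_one
    refine ⟨slice π i ξ b, slice_mem_subTensor_insert π hξ hb, ?_⟩
    rw [Finset.sum_insert hi]
    calc ‖a - slice π i ξ b‖ = ‖(a - slice π i ξ a) + slice π i ξ (a - b)‖ := by
          rw [map_sub, sub_add_sub_cancel]
      _ ≤ ‖a - slice π i ξ a‖ + ‖slice π i ξ (a - b)‖ := norm_add_le _ _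
      _ ≤ _ := add_le_add (norm_sub_slice_le π hξ a)
        ((ContinuousLinearMap.le_of_opNorm_le _ (norm_slice_le π hξ) _).trans (by rwa [one_mul]))

omit [DecidableEq ι] in
theorem infDist_span_one_le_sum [∀ i, Nontrivial (H i)] (a : minTensor π) :
    Metric.infDist a (Submodule.span ℂ {(1 : minTensor π)}) ≤
      ∑ i, 2 * Metric.infDist a (subTensor π {i}) := by
  obtain ⟨b, hb, hab⟩ := exists_mem_subTensor_norm_sub_le π a Finset.univ
  exact (Metric.infDist_le_dist_of_mem (subTensor_univ_le π hb)).trans (by rwa [dist_eq_norm])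

end SliceMaps

section PositiveFunctionals

variable {B : Type*} [CStarAlgebra B]

theorem norm_apply_le_norm_apply_one_mul [PartialOrder B] [StarOrderedRing B] (f : B →ₚ[ℂ] ℂ)
    (b : B) : ‖f b‖ ≤ ‖f 1‖ * ‖b‖ := by
  have norm_sq_eq (c : B) : ‖f.toPreGNS c‖ ^ 2 = ‖f (star c * c)‖ := by
    simpa using congrArg norm (f.preGNS_norm_sq (f.toPreGNS c))
  have norm_mul_le : ‖f b‖ ≤ ‖f.toPreGNS 1‖ * ‖f.toPreGNS b‖ := by
    simpa [f.preGNS_inner_def] using norm_inner_le_norm (𝕜 := ℂ) (f.toPreGNS 1) (f.toPreGNS b)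
  refine le_of_sq_le_sq ?_ (by positivity)
  calc ‖f b‖ ^ 2 ≤ (‖f.toPreGNS 1‖ * ‖f.toPreGNS b‖) ^ 2 := by gcongr
    _ = ‖f 1‖ * ‖f (star b * b)‖ := by
      rw [mul_pow, norm_sq_eq, norm_sq_eq, star_one, one_mul]
    _ ≤ ‖f 1‖ * (‖f 1‖ * ‖star b * b‖) := by
      gcongr
      exact f.norm_apply_le_of_nonneg _ (star_mul_self_nonneg b)
    _ = (‖f 1‖ * ‖b‖) ^ 2 := by rw [CStarRing.norm_star_mul_self]; ring

variable {φ : B →L[ℂ] ℂ}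

theorem exists_positiveLinearMap_eq [PartialOrder B] [StarOrderedRing B]
    (hφ : ∀ b, 0 ≤ φ (star b * b)) : ∃ f : B →ₚ[ℂ] ℂ, ∀ b, f b = φ b :=
  ⟨.mk₀ φ.toLinearMap fun x hx => by
    obtain ⟨b, rfl⟩ := CStarAlgebra.nonneg_iff_eq_star_mul_self.1 hx
    exact hφ b, fun _ => rfl⟩

theorem isSelfAdjointFunctional_of_nonneg (hφ : ∀ b, 0 ≤ φ (star b * b)) :
    IsSelfAdjointFunctional φ := by
  let _ := CStarAlgebra.spectralOrder B
  have := CStarAlgebra.spectralOrderedRing B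
  obtain ⟨f, hf⟩ := exists_positiveLinearMap_eq hφ
  intro b
  simp [← hf, map_star]

theorem opNorm_eq_norm_apply_one (hφ : ∀ b, 0 ≤ φ (star b * b)) : ‖φ‖ = ‖φ 1‖ := by
  let _ := CStarAlgebra.spectralOrder B
  have := CStarAlgebra.spectralOrderedRing B
  obtain ⟨f, hf⟩ := exists_positiveLinearMap_eq hφ
  refine le_antisymm (φ.opNorm_le_bound (norm_nonneg _) fun b => ?_) ?_
  · simpa only [hf] using norm_apply_le_norm_apply_one_mul f b
  · obtain _ | _ := subsingleton_or_nontrivial B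
    · simp [Subsingleton.elim (1 : B) 0]
    · exact φ.unit_le_opNorm 1 norm_one.le

theorem isState_iff : IsState φ ↔ (∀ b, 0 ≤ φ (star b * b)) ∧ φ 1 = 1 := by
  refine and_congr_right fun hφ => ?_
  have h1 : 0 ≤ φ 1 := by simpa using hφ 1
  rw [opNorm_eq_norm_apply_one hφ, ← Complex.ofReal_inj, ← Complex.eq_coe_norm_of_nonneg h1]
  simp

end PositiveFunctionals

section States

variable {ι : Type*} [Fintype ι] {A : ι → Type*} [∀ i, CStarAlgebra (A i)]
  {H : ι → Type*} [∀ i, NormedAddCommGroup (H i)] [∀ i, InnerProductSpace ℂ (H i)]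
  [∀ i, CompleteSpace (H i)] {π : ∀ i, A i →⋆ₐ[ℂ] (H i →L[ℂ] H i)} {φ : minTensor π →L[ℂ] ℂ}

variable (π) in
/-- The C*-algebra structure of `⊗ᵢ Aᵢ`. -/
abbrev minTensorCStarAlgebra : CStarAlgebra (minTensor π) :=
  StarSubalgebra.cstarAlgebra (minTensor π) (h_closed := isClosed_minTensor π)

theorem isState_minTensor_iff : IsState φ ↔ (∀ b, 0 ≤ φ (star b * b)) ∧ φ 1 = 1 :=
  @isState_iff (minTensor π) (minTensorCStarAlgebra π) φ

theorem isSelfAdjointFunctional_minTensor_of_nonneg (hφ : ∀ b, 0 ≤ φ (star b * b)) :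
    IsSelfAdjointFunctional φ :=
  @isSelfAdjointFunctional_of_nonneg (minTensor π) (minTensorCStarAlgebra π) φ hφ

end States

section SelfAdjointPart

variable {B : Type*} [NormedRing B] [StarRing B] [NormedStarGroup B] [NormedAlgebra ℂ B]
  [StarModule ℂ B]

/-- The functional `φ*(b) = conj φ(b*)`. -/
def adjointFunctional (φ : B →L[ℂ] ℂ) : B →L[ℂ] ℂ :=
  (starL ℂ : ℂ ≃L⋆[ℂ] ℂ).toContinuousLinearMap.comp
    (φ.comp (starL ℂ : B ≃L⋆[ℂ] B).toContinuousLinearMap)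

theorem adjointFunctional_apply (φ : B →L[ℂ] ℂ) (b : B) :
    adjointFunctional φ b = starRingEnd ℂ (φ (star b)) :=
  rfl

theorem norm_adjointFunctional_le (φ : B →L[ℂ] ℂ) : ‖adjointFunctional φ‖ ≤ ‖φ‖ :=
  (adjointFunctional φ).opNorm_le_bound (norm_nonneg _) fun b => by
    simpa [adjointFunctional_apply] using φ.le_opNorm (star b)

/-- The self-adjoint part `(φ + φ*) / 2` of a functional. -/
def realPartFunctional (φ : B →L[ℂ] ℂ) : B →L[ℂ] ℂ :=
  (2⁻¹ : ℂ) • (φ + adjointFunctional φ)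

theorem realPartFunctional_apply (φ : B →L[ℂ] ℂ) (b : B) :
    realPartFunctional φ b = 2⁻¹ * (φ b + starRingEnd ℂ (φ (star b))) :=
  rfl

theorem isSelfAdjointFunctional_realPartFunctional (φ : B →L[ℂ] ℂ) :
    IsSelfAdjointFunctional (realPartFunctional φ) := fun b => by
  simp [realPartFunctional_apply, add_comm, Complex.conj_ofNat]

theorem norm_realPartFunctional_le (φ : B →L[ℂ] ℂ) : ‖realPartFunctional φ‖ ≤ ‖φ‖ :=
  calc ‖realPartFunctional φ‖ = 2⁻¹ * ‖φ + adjointFunctional φ‖ := by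
        rw [realPartFunctional, norm_smul, norm_inv, Complex.norm_two]
    _ ≤ 2⁻¹ * (‖φ‖ + ‖φ‖) := by
        gcongr
        exact norm_add_le_of_le le_rfl (norm_adjointFunctional_le φ)
    _ = ‖φ‖ := by ring

theorem realPartFunctional_sum {ι : Type*} [Fintype ι] (φ : ι → B →L[ℂ] ℂ) :
    realPartFunctional (∑ i, φ i) = ∑ i, realPartFunctional (φ i) := by
  ext b
  simp [realPartFunctional_apply, Finset.mul_sum, Finset.sum_add_distrib, mul_add]

theorem realPartFunctional_eq_self {φ : B →L[ℂ] ℂ} (hφ : IsSelfAdjointFunctional φ) :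
    realPartFunctional φ = φ := by
  ext b
  rw [realPartFunctional_apply, hφ b]
  ring

end SelfAdjointPart

section Duality

variable {ι : Type*} [Fintype ι] {A : ι → Type*} [∀ i, CStarAlgebra (A i)]
  {H : ι → Type*} [∀ i, NormedAddCommGroup (H i)] [∀ i, InnerProductSpace ℂ (H i)]
  [∀ i, CompleteSpace (H i)] (π : ∀ i, A i →⋆ₐ[ℂ] (H i →L[ℂ] H i))

theorem partialL_eq_infDist (i : ι) (a : minTensor π) :
    partialL π i a = 2 * Metric.infDist a (subTensor π {i}) := by
  rw [partialL, ← tilde_toSubmodule, Metric.infDist_eq_iInf]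
  simp only [dist_eq_norm]
  rfl

variable {π}

theorem hammingL_le_one_iff {a : minTensor π} :
    hammingL π a ≤ 1 ↔ ∀ i, partialL π i a ≤ 1 :=
  ⟨fun h i => (le_ciSup (Set.finite_range _).bddAbove i).trans h,
    fun h => Real.iSup_le h zero_le_one⟩

theorem partialL_half_smul (i : ι) (a : minTensor π) :
    partialL π i ((2⁻¹ : ℂ) • a) = Metric.infDist a (subTensor π {i}) := by
  rw [partialL_eq_infDist, infDist_smul, norm_inv, Complex.norm_two,
    mul_inv_cancel_left₀ two_ne_zero]

theorem dualNorm_eq_ofReal_opNorm {i : ι} {φ : minTensor π →L[ℂ] ℂ}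
    (hφ : ∀ c ∈ tilde π i, φ c = 0) : dualNorm π i φ = ENNReal.ofReal (‖φ‖ / 2) := by
  have le : dualNorm π i φ ≤ ENNReal.ofReal (‖φ‖ / 2) := by
    refine iSup₂_le fun a ha => ENNReal.ofReal_le_ofReal ?_
    rw [partialL_eq_infDist] at ha
    calc ‖φ a‖ ≤ ‖φ‖ * Metric.infDist a (subTensor π {i}) :=
          norm_apply_le_opNorm_mul_infDist (fun c hc => hφ c ((mem_tilde_iff π).2 hc)) a
      _ ≤ ‖φ‖ * (1 / 2) := by gcongr; linarith
      _ = ‖φ‖ / 2 := by ring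
  have ne_top := ne_top_of_le_ne_top ENNReal.ofReal_ne_top le
  refine le.antisymm ((ENNReal.ofReal_le_iff_le_toReal ne_top).2 ?_)
  suffices ‖φ‖ ≤ 2 * (dualNorm π i φ).toReal by linarith
  refine opNorm_le_of_unit fun a ha => ?_
  have half_smul_le : partialL π i ((2⁻¹ : ℂ) • a) ≤ 1 := by
    rw [partialL_half_smul]
    exact (Metric.infDist_le_dist_of_mem (zero_mem _)).trans (by rwa [dist_zero_right])
  have apply_le : ENNReal.ofReal ‖φ ((2⁻¹ : ℂ) • a)‖ ≤ dualNorm π i φ :=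
    le_iSup₂_of_le _ half_smul_le le_rfl
  rw [ENNReal.ofReal_le_iff_le_toReal ne_top, map_smul, norm_smul, norm_inv,
    Complex.norm_two] at apply_le
  linarith

theorem hammingDist_le_sum_dualNorm {μ ν : minTensor π →L[ℂ] ℂ} {φ : ι → minTensor π →L[ℂ] ℂ}
    (h : μ - ν = ∑ i, φ i) : hammingDist π μ ν ≤ ∑ i, dualNorm π i (φ i) := by
  refine iSup₂_le fun a ha => ?_
  have sub_eq : μ a - ν a = ∑ i, φ i a := by rw [← sub_apply, h, sum_apply]
  calc ENNReal.ofReal ‖μ a - ν a‖ ≤ ENNReal.ofReal (∑ i, ‖φ i a‖) := by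
        rw [sub_eq]
        exact ENNReal.ofReal_le_ofReal (norm_sum_le _ _)
    _ = ∑ i, ENNReal.ofReal ‖φ i a‖ := ENNReal.ofReal_sum_of_nonneg fun _ _ => norm_nonneg _
    _ ≤ ∑ i, dualNorm π i (φ i) :=
        Finset.sum_le_sum fun i _ => le_iSup₂_of_le a (hammingL_le_one_iff.1 ha i) le_rfl

variable {μ ν : minTensor π →L[ℂ] ℂ}

theorem hammingDist_ne_top (h : μ 1 = ν 1) : hammingDist π μ ν ≠ ⊤ := by
  refine ne_top_of_le_ne_top (ENNReal.ofReal_ne_top (r := ‖μ - ν‖ * ∑ _i : ι, 1))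
    (iSup₂_le fun a ha => ENNReal.ofReal_le_ofReal ?_)
  obtain _ | _ := subsingleton_or_nontrivial (minTensor π)
  · rw [Subsingleton.elim a 0, map_zero, map_zero, sub_zero, norm_zero]
    positivity
  have := nontrivial_factor π
  have vanish : ∀ c ∈ Submodule.span ℂ {(1 : minTensor π)}, (μ - ν) c = 0 := fun c hc => by
    obtain ⟨z, rfl⟩ := Submodule.mem_span_singleton.1 hc
    simp [h]
  calc ‖(μ - ν) a‖ ≤ ‖μ - ν‖ * Metric.infDist a (Submodule.span ℂ {(1 : minTensor π)}) :=
        norm_apply_le_opNorm_mul_infDist vanish a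
    _ ≤ ‖μ - ν‖ * ∑ i, partialL π i a := by
        simp only [partialL_eq_infDist]
        gcongr
        exact infDist_span_one_le_sum π a
    _ ≤ ‖μ - ν‖ * ∑ _i, 1 := by
        gcongr with i
        exact hammingL_le_one_iff.1 ha i

theorem exists_sub_eq_sum_of_apply_one_eq (h : μ 1 = ν 1) :
    ∃ φ : ι → minTensor π →L[ℂ] ℂ, (∀ i, ∀ c ∈ tilde π i, φ i c = 0) ∧ μ - ν = ∑ i, φ i ∧
      ∑ i, ‖φ i‖ ≤ 2 * (hammingDist π μ ν).toReal := by
  simp only [mem_tilde_iff]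
  refine exists_eq_sum_of_forall_infDist_le_one _ fun a ha => ?_
  have half_smul_le : hammingL π ((2⁻¹ : ℂ) • a) ≤ 1 :=
    hammingL_le_one_iff.2 fun i => (partialL_half_smul i a).trans_le (ha i)
  have apply_le : ENNReal.ofReal ‖(μ - ν) ((2⁻¹ : ℂ) • a)‖ ≤ hammingDist π μ ν :=
    le_iSup₂_of_le (f := fun a (_ : hammingL π a ≤ 1) => ENNReal.ofReal ‖μ a - ν a‖)
      _ half_smul_le le_rfl
  rw [ENNReal.ofReal_le_iff_le_toReal (hammingDist_ne_top h), map_smul, norm_smul, norm_inv,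
    Complex.norm_two] at apply_le
  linarith

theorem hammingDist_eq_iInf_sum_dualNorm (h : μ 1 = ν 1)
    (hsa : IsSelfAdjointFunctional (μ - ν)) :
    hammingDist π μ ν = ⨅ (φ : ι → (minTensor π →L[ℂ] ℂ))
      (_ : (∀ i, (∀ c ∈ tilde π i, φ i c = 0) ∧ IsSelfAdjointFunctional (φ i)) ∧
        μ - ν = ∑ i, φ i), ∑ i, dualNorm π i (φ i) := by
  refine le_antisymm (le_iInf₂ fun φ hφ => hammingDist_le_sum_dualNorm hφ.2) ?_
  obtain ⟨φ, vanish, sub_eq, norm_le⟩ := exists_sub_eq_sum_of_apply_one_eq h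
  have vanish_re (i : ι) : ∀ c ∈ tilde π i, realPartFunctional (φ i) c = 0 := fun c hc => by
    simp [realPartFunctional_apply, vanish i c hc, vanish i (star c) (star_mem hc)]
  have sub_eq_re : μ - ν = ∑ i, realPartFunctional (φ i) := by
    rw [← realPartFunctional_sum, ← sub_eq, realPartFunctional_eq_self hsa]
  refine iInf₂_le_of_le (fun i => realPartFunctional (φ i))
    ⟨fun i => ⟨vanish_re i, isSelfAdjointFunctional_realPartFunctional _⟩, sub_eq_re⟩ ?_
  calc ∑ i, dualNorm π i (realPartFunctional (φ i))
      = ∑ i, ENNReal.ofReal (‖realPartFunctional (φ i)‖ / 2) :=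
        Finset.sum_congr rfl fun i _ => dualNorm_eq_ofReal_opNorm (vanish_re i)
    _ = ENNReal.ofReal (∑ i, ‖realPartFunctional (φ i)‖ / 2) :=
        (ENNReal.ofReal_sum_of_nonneg fun _ _ => by positivity).symm
    _ ≤ ENNReal.ofReal (hammingDist π μ ν).toReal := by
        gcongr
        rw [← Finset.sum_div, div_le_iff₀' two_pos]
        exact (Finset.sum_le_sum fun i _ => norm_realPartFunctional_le (φ i)).trans norm_le
    _ = hammingDist π μ ν := ENNReal.ofReal_toReal (hammingDist_ne_top h)

theorem IsState.sub_isSelfAdjointFunctional (hμ : IsState μ) (hν : IsState ν) :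
    IsSelfAdjointFunctional (μ - ν) := fun b => by
  simp [isSelfAdjointFunctional_minTensor_of_nonneg hμ.1 b,
    isSelfAdjointFunctional_minTensor_of_nonneg hν.1 b]

end Duality

section TraceNorm

open scoped MatrixOrder

variable {n : Type*} [Fintype n] [DecidableEq n] {X : Matrix n n ℂ}

theorem trace_cfc (hX : X.IsHermitian) (f : ℝ → ℝ) :
    (cfc f X).trace = ((∑ k, f (hX.eigenvalues k) : ℝ) : ℂ) := by
  rw [hX.cfc_eq, Matrix.IsHermitian.cfc, Unitary.conjStarAlgAut_apply, Matrix.trace_mul_cycle,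
    Unitary.coe_star_mul_self, one_mul, Matrix.trace_diagonal, Complex.ofReal_sum]
  rfl

theorem coe_traceNorm (X : Matrix n n ℂ) : (traceNorm X : ℂ) = (CFC.abs X).trace := by
  rw [traceNorm, ← trace_cfc, CFC.abs, CFC.sqrt_eq_real_sqrt _ (star_mul_self_nonneg X),
    cfcₙ_eq_cfc]
  rfl

theorem traceNorm_nonneg (X : Matrix n n ℂ) : 0 ≤ traceNorm X :=
  Finset.sum_nonneg fun _ _ => Real.sqrt_nonneg _

theorem exists_posSemidef_sub_eq (hX : X.IsHermitian) : ∃ P N : Matrix n n ℂ,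
    P.PosSemidef ∧ N.PosSemidef ∧ X = P - N ∧ (traceNorm X : ℂ) = P.trace + N.trace := by
  refine ⟨X⁺, X⁻, Matrix.nonneg_iff_posSemidef.1 (CFC.posPart_nonneg X),
    Matrix.nonneg_iff_posSemidef.1 (CFC.negPart_nonneg X), (CFC.posPart_sub_negPart X hX).symm, ?_⟩
  rw [coe_traceNorm, ← CFC.posPart_add_negPart X hX, Matrix.trace_add]

theorem exists_isHermitian_mul_eq_abs (hX : X.IsHermitian) : ∃ S : Matrix n n ℂ,
    S.IsHermitian ∧ S * S = 1 ∧ X * S = CFC.abs X := by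
  have hcont (f : ℝ → ℝ) : ContinuousOn f (spectrum ℝ X) :=
    Matrix.finite_real_spectrum.continuousOn f
  let sgn : ℝ → ℝ := fun x => if 0 ≤ x then 1 else -1
  refine ⟨cfc sgn X, cfc_predicate sgn X, ?_, ?_⟩
  · rw [← cfc_mul sgn sgn X (hcont _) (hcont _), ← cfc_one ℝ X hX.isSelfAdjoint]
    refine cfc_congr fun x _ => ?_
    simp only [sgn]
    split_ifs <;> simp
  · nth_rw 1 [← cfc_id ℝ X hX.isSelfAdjoint]
    rw [← cfc_mul id sgn X (hcont _) (hcont _), CFC.abs_eq_cfc_norm X hX.isSelfAdjoint]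
    refine cfc_congr fun x _ => ?_
    simp only [sgn, id, Real.norm_eq_abs]
    split_ifs with hx
    · rw [mul_one, abs_of_nonneg hx]
    · rw [mul_neg_one, abs_of_neg (not_le.1 hx)]

theorem trace_mul_le_trace {P S : Matrix n n ℂ} (hP : P.PosSemidef) (hS : S.IsHermitian)
    (hS2 : S * S = 1) : (P * S).trace ≤ P.trace := by
  have hsq : (1 - S) * (1 - S) = (2 : ℝ) • (1 - S) := by
    simp only [sub_mul, mul_sub, hS2, one_mul, mul_one]
    module
  have hnonneg := (hP.mul_mul_conjTranspose_same (1 - S)).trace_nonneg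
  rw [Matrix.conjTranspose_sub, Matrix.conjTranspose_one, hS.eq, Matrix.trace_mul_comm,
    ← mul_assoc, hsq, smul_mul_assoc, Matrix.trace_smul, sub_mul, one_mul,
    Matrix.trace_sub, Matrix.trace_mul_comm S P] at hnonneg
  exact sub_nonneg.1 ((smul_nonneg_iff_nonneg_of_pos_left two_pos).1 hnonneg)

theorem coe_traceNorm_sub_le {P N : Matrix n n ℂ} (hP : P.PosSemidef) (hN : N.PosSemidef) :
    (traceNorm (P - N) : ℂ) ≤ P.trace + N.trace := by
  obtain ⟨S, hS, hS2, habs⟩ := exists_isHermitian_mul_eq_abs (hP.isHermitian.sub hN.isHermitian)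
  calc (traceNorm (P - N) : ℂ) = (P * S).trace + (N * -S).trace := by
        rw [coe_traceNorm, ← habs, sub_mul, Matrix.trace_sub, mul_neg, Matrix.trace_neg,
          sub_eq_add_neg]
    _ ≤ P.trace + N.trace := add_le_add (trace_mul_le_trace hP hS hS2)
        (trace_mul_le_trace hN hS.neg (by rw [neg_mul_neg, hS2]))

end TraceNorm

section Kron

variable {ι : Type*} [Fintype ι] {κ : ι → Type*}

theorem kron_piSplitAt_symm [DecidableEq ι] (i : ι) (a : ∀ j, CStarMatrix (κ j) (κ j) ℂ)
    (m m' : κ i) (k l : ∀ j : {j // j ≠ i}, κ j) :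
    kron a ((Equiv.piSplitAt i κ).symm (m, k)) ((Equiv.piSplitAt i κ).symm (m', l)) =
      a i m m' * kron (fun j : {j // j ≠ i} => a j) k l := by
  simp only [kron, Matrix.of_apply]
  rw [Fintype.prod_eq_mul_prod_subtype_ne _ i]
  congr 1
  · simp
  · exact Finset.prod_congr rfl fun j _ => by simp [j.2]

theorem kron_mul [DecidableEq ι] [∀ i, Fintype (κ i)] (a b : ∀ i, CStarMatrix (κ i) (κ i) ℂ) :
    kron (a * b) = kron a * kron b := by
  ext k l
  simp only [kron, Matrix.of_apply, Matrix.mul_apply, Pi.mul_apply, CStarMatrix.mul_apply,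
    Fintype.prod_sum, Finset.prod_mul_distrib]

theorem kron_star (a : ∀ i, CStarMatrix (κ i) (κ i) ℂ) : kron (star a) = star (kron a) := by
  ext k l
  simp only [kron, Matrix.of_apply, Matrix.star_apply, Pi.star_apply, CStarMatrix.star_apply,
    star_prod]

/-- The Kronecker product as a multilinear function of its factors. -/
def kronMultilinear : MultilinearMap ℂ (fun i => CStarMatrix (κ i) (κ i) ℂ)
    (Matrix (∀ i, κ i) (∀ i, κ i) ℂ) where
  toFun := kron
  map_update_add' a i x y := by
    ext k l
    simp only [kron, Matrix.of_apply, Matrix.add_apply, Fintype.prod_eq_mul_prod_subtype_ne _ i,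
      Function.update_self, CStarMatrix.add_apply, add_mul]
    congr 2 <;> exact Finset.prod_congr rfl fun j _ => by simp [j.2]
  map_update_smul' a i c x := by
    ext k l
    simp only [kron, Matrix.of_apply, Matrix.smul_apply, Fintype.prod_eq_mul_prod_subtype_ne _ i,
      Function.update_self, CStarMatrix.smul_apply, smul_mul_assoc]
    congr 2
    exact Finset.prod_congr rfl fun j _ => by simp [j.2]

section

variable [∀ i, DecidableEq (κ i)]

theorem kron_one : kron (1 : ∀ i, CStarMatrix (κ i) (κ i) ℂ) = 1 := by
  classical
  ext k l
  simp only [kron, Matrix.of_apply, Pi.one_apply, CStarMatrix.one_apply, Matrix.one_apply,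
    Fintype.prod_ite_zero, Finset.prod_const_one, funext_iff]

theorem kron_single (k l : ∀ i, κ i) :
    kron (fun i => CStarMatrix.ofMatrix (Matrix.single (k i) (l i) (1 : ℂ))) =
      Matrix.single k l 1 := by
  classical
  ext p q
  simp only [kron, Matrix.of_apply, CStarMatrix.ofMatrix_apply, Matrix.single_apply,
    Fintype.prod_ite_zero, Finset.prod_const_one, forall_and, funext_iff]

end

variable [∀ i, Finite (κ i)] {V : Type*} [AddCommMonoid V] [Module ℂ V]

theorem linearMap_ext_kron {f g : Matrix (∀ i, κ i) (∀ i, κ i) ℂ →ₗ[ℂ] V}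
    (h : ∀ a, f (kron a) = g (kron a)) : f = g := by
  classical
  refine Matrix.ext_linearMap (R := ℂ) fun k l => LinearMap.ext_ring ?_
  have hkl := h fun i => CStarMatrix.ofMatrix (Matrix.single (k i) (l i) 1)
  rwa [kron_single] at hkl

omit [Fintype ι] in
theorem multilinearMap_ext_single [Finite ι] [∀ i, DecidableEq (κ i)]
    {f g : MultilinearMap ℂ (fun i => CStarMatrix (κ i) (κ i) ℂ) V}
    (h : ∀ k l : ∀ i, κ i,
      f (fun i => CStarMatrix.ofMatrix (Matrix.single (k i) (l i) 1)) =
        g fun i => CStarMatrix.ofMatrix (Matrix.single (k i) (l i) 1)) : f = g := by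
  have (i : ι) := Fintype.ofFinite (κ i)
  refine Module.Basis.ext_multilinear
    (fun i => (Matrix.stdBasis ℂ (κ i) (κ i)).map CStarMatrix.ofMatrixₗ) fun p => ?_
  have hbasis (i : ι) : Matrix.stdBasis ℂ (κ i) (κ i) (p i) =
      Matrix.single (p i).1 (p i).2 1 := Matrix.stdBasis_eq_single ..
  simp only [Module.Basis.map_apply, hbasis]
  exact h (fun i => (p i).1) fun i => (p i).2

omit [∀ i, Finite (κ i)] in
theorem ext_trace_mul_kron [DecidableEq ι] [∀ i, Fintype (κ i)]
    {X Y : Matrix (∀ i, κ i) (∀ i, κ i) ℂ}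
    (h : ∀ a : ∀ i, CStarMatrix (κ i) (κ i) ℂ, (X * kron a).trace = (Y * kron a).trace) :
    X = Y := by
  refine Matrix.ext_iff_trace_mul_right.2 fun M => ?_
  exact LinearMap.congr_fun (linearMap_ext_kron
    (f := Matrix.traceLinearMap _ ℂ ℂ ∘ₗ LinearMap.mulLeft ℂ X)
    (g := Matrix.traceLinearMap _ ℂ ℂ ∘ₗ LinearMap.mulLeft ℂ Y) h) M

end Kron

section PartialTrace

variable {ι : Type*} [DecidableEq ι] {κ : ι → Type*} [∀ i, Fintype (κ i)]

theorem partialTrace_sub (i : ι) (X Y : Matrix (∀ j, κ j) (∀ j, κ j) ℂ) :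
    partialTrace i (X - Y) = partialTrace i X - partialTrace i Y := by
  ext k l
  simp [partialTrace, Finset.sum_sub_distrib]

theorem partialTrace_smul (i : ι) (c : ℂ) (X : Matrix (∀ j, κ j) (∀ j, κ j) ℂ) :
    partialTrace i (c • X) = c • partialTrace i X := by
  ext k l
  simp [partialTrace, Finset.mul_sum]

variable [Fintype ι]

theorem sum_piSplitAt {M : Type*} [AddCommMonoid M] (i : ι) (f : (∀ j, κ j) → M) :
    ∑ p, f p = ∑ k : ∀ j : {j // j ≠ i}, κ j, ∑ m, f ((Equiv.piSplitAt i κ).symm (m, k)) := by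
  rw [← (Equiv.piSplitAt i κ).symm.sum_comp, Fintype.sum_prod_type_right]

theorem trace_partialTrace (i : ι) (X : Matrix (∀ j, κ j) (∀ j, κ j) ℂ) :
    (partialTrace i X).trace = X.trace := by
  simp only [Matrix.trace, sum_piSplitAt i, Matrix.diag, partialTrace, Matrix.of_apply]

variable [∀ i, DecidableEq (κ i)]

theorem trace_mul_kron_of_eq_one {i : ι} (X : Matrix (∀ j, κ j) (∀ j, κ j) ℂ)
    {a : ∀ j, CStarMatrix (κ j) (κ j) ℂ} (ha : a i = 1) :
    (X * kron a).trace = (partialTrace i X * kron fun j : {j // j ≠ i} => a j).trace := by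
  simp only [Matrix.trace, Matrix.diag, Matrix.mul_apply, sum_piSplitAt i, kron_piSplitAt_symm, ha,
    CStarMatrix.one_apply, ite_mul, one_mul, zero_mul, mul_ite, mul_zero, Finset.sum_ite_eq',
    Finset.mem_univ, if_true, partialTrace, Matrix.of_apply, Finset.sum_mul]
  exact Finset.sum_congr rfl fun k _ => Finset.sum_comm

theorem partialTrace_eq_zero_iff (i : ι) (X : Matrix (∀ j, κ j) (∀ j, κ j) ℂ) :
    partialTrace i X = 0 ↔
      ∀ a : ∀ j, CStarMatrix (κ j) (κ j) ℂ, a i = 1 → (X * kron a).trace = 0 := by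
  refine ⟨fun h a ha => by rw [trace_mul_kron_of_eq_one X ha, h, zero_mul, Matrix.trace_zero],
    fun h => ext_trace_mul_kron fun b => ?_⟩
  let a : ∀ j, CStarMatrix (κ j) (κ j) ℂ := fun j => if hj : j ≠ i then b ⟨j, hj⟩ else 1
  have hab : (fun j : {j // j ≠ i} => a j) = b := funext fun j => dif_pos j.2
  have ha : a i = 1 := dif_neg (not_not.2 rfl)
  rw [zero_mul, Matrix.trace_zero, ← h a ha, trace_mul_kron_of_eq_one X ha, hab]

end PartialTrace

section Wasserstein

variable {ι : Type*} [Fintype ι] [DecidableEq ι] {κ : ι → Type*} [∀ i, Fintype (κ i)]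
  [∀ i, DecidableEq (κ i)] {ρ σ : Matrix (∀ i, κ i) (∀ i, κ i) ℂ}

theorem traceNorm_smul_sub_le {n : Type*} [Fintype n] [DecidableEq n] {R S : Matrix n n ℂ}
    (hR : IsDensityMatrix R) (hS : IsDensityMatrix S) (c : ℝ≥0) :
    traceNorm (((c : ℝ) : ℂ) • (R - S)) ≤ 2 * c := by
  have hc : (0 : ℂ) ≤ ((c : ℝ) : ℂ) := Complex.zero_le_real.2 c.2
  have hle := coe_traceNorm_sub_le (hR.1.smul hc) (hS.1.smul hc)
  rw [← smul_sub, Matrix.trace_smul, Matrix.trace_smul, hR.2, hS.2, smul_eq_mul, mul_one,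
    ← two_mul] at hle
  exact_mod_cast hle

theorem wassersteinOne_le_wassersteinOneNeighbor (ρ σ : Matrix (∀ i, κ i) (∀ i, κ i) ℂ) :
    wassersteinOne ρ σ ≤ wassersteinOneNeighbor ρ σ := by
  refine le_iInf fun c => le_iInf fun R => le_iInf fun S => le_iInf fun ⟨hRS, hsum⟩ => ?_
  have hherm (i : ι) : (((c i : ℝ) : ℂ) • (R i - S i)).IsHermitian :=
    ((hRS i).1.1.isHermitian.sub (hRS i).2.1.1.isHermitian).smul (Complex.conj_ofReal _)
  have hpartial (i : ι) : partialTrace i (((c i : ℝ) : ℂ) • (R i - S i)) = 0 := by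
    rw [partialTrace_smul, partialTrace_sub, (hRS i).2.2, sub_self, smul_zero]
  have hnorm : 1 / 2 * ∑ i, traceNorm (((c i : ℝ) : ℂ) • (R i - S i)) ≤ ∑ i, (c i : ℝ) := by
    have hle := Finset.sum_le_sum fun i (_ : i ∈ Finset.univ) =>
      traceNorm_smul_sub_le (hRS i).1 (hRS i).2.1 (c i)
    rw [← Finset.mul_sum] at hle
    linarith
  refine iInf₂_le_of_le _ ⟨fun i => ⟨hherm i, hpartial i⟩, hsum⟩
    ((ENNReal.ofReal_le_ofReal hnorm).trans_eq ?_)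
  rw [ENNReal.ofReal_sum_of_nonneg fun i _ => NNReal.coe_nonneg (c i)]
  simp only [ENNReal.ofReal_coe_nnreal]

theorem isDensityMatrix_inv_smul {n : Type*} [Fintype n] {P : Matrix n n ℂ} {c : ℝ}
    (hP : P.PosSemidef) (htr : P.trace = c) (hc : c ≠ 0) : IsDensityMatrix ((c : ℂ)⁻¹ • P) := by
  have hnonneg : (0 : ℂ) ≤ (c : ℂ)⁻¹ := inv_nonneg.2 (htr ▸ hP.trace_nonneg)
  exact ⟨hP.smul hnonneg, by
    rw [Matrix.trace_smul, htr, smul_eq_mul, inv_mul_cancel₀ (Complex.ofReal_ne_zero.2 hc)]⟩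

theorem exists_isDensityMatrix_eq_smul_sub {i : ι} {X : Matrix (∀ i, κ i) (∀ i, κ i) ℂ}
    (hX : X.IsHermitian) (hX0 : partialTrace i X = 0) (hρ : IsDensityMatrix ρ) :
    ∃ R S : Matrix (∀ i, κ i) (∀ i, κ i) ℂ, IsDensityMatrix R ∧ IsDensityMatrix S ∧
      partialTrace i R = partialTrace i S ∧ X = ((1 / 2 * traceNorm X : ℝ) : ℂ) • (R - S) := by
  obtain ⟨P, N, hP, hN, hPN, hnorm⟩ := exists_posSemidef_sub_eq hX
  have hpartial : partialTrace i P = partialTrace i N := by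
    rw [← sub_eq_zero, ← partialTrace_sub, ← hPN, hX0]
  have htr : P.trace = N.trace := by rw [← trace_partialTrace i, hpartial, trace_partialTrace]
  have hN' : N.trace = ((1 / 2 * traceNorm X : ℝ) : ℂ) := by
    push_cast
    rw [hnorm, htr]
    ring
  have hP' := htr.trans hN'
  set c : ℝ := 1 / 2 * traceNorm X
  rcases eq_or_ne c 0 with hc | hc
  · rw [hc, Complex.ofReal_zero] at hP' hN'
    refine ⟨ρ, ρ, hρ, hρ, rfl, ?_⟩
    rw [sub_self, smul_zero, hPN, hP.trace_eq_zero_iff.1 hP', hN.trace_eq_zero_iff.1 hN', sub_zero]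
  · refine ⟨(c : ℂ)⁻¹ • P, (c : ℂ)⁻¹ • N, isDensityMatrix_inv_smul hP hP' hc,
      isDensityMatrix_inv_smul hN hN' hc, ?_, ?_⟩
    · rw [partialTrace_smul, partialTrace_smul, hpartial]
    · rw [← smul_sub, ← hPN, smul_inv_smul₀ (Complex.ofReal_ne_zero.2 hc)]

theorem wassersteinOneNeighbor_le_wassersteinOne (hρ : IsDensityMatrix ρ) :
    wassersteinOneNeighbor ρ σ ≤ wassersteinOne ρ σ := by
  refine le_iInf₂ fun X ⟨hX, hsum⟩ => ?_
  choose R S hR hS hRS hXRS using fun i =>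
    exists_isDensityMatrix_eq_smul_sub (hX i).1 (hX i).2 hρ
  have hnonneg (i : ι) : 0 ≤ 1 / 2 * traceNorm (X i) :=
    mul_nonneg one_half_pos.le (traceNorm_nonneg (X i))
  let c : ι → ℝ≥0 := fun i => ⟨1 / 2 * traceNorm (X i), hnonneg i⟩
  have hdecomp : ρ - σ = ∑ i, ((c i : ℝ) : ℂ) • (R i - S i) :=
    hsum.trans (Finset.sum_congr rfl fun i _ => hXRS i)
  refine iInf_le_of_le c (iInf_le_of_le R (iInf_le_of_le S
    (iInf_le_of_le ⟨fun i => ⟨hR i, hS i, hRS i⟩, hdecomp⟩ (le_of_eq ?_))))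
  rw [Finset.mul_sum, ENNReal.ofReal_sum_of_nonneg fun i _ => hnonneg i]
  exact Finset.sum_congr rfl fun i _ => (ENNReal.ofReal_eq_coe_nnreal (hnonneg i)).symm

theorem wassersteinOne_eq_wassersteinOneNeighbor (hρ : IsDensityMatrix ρ) :
    wassersteinOne ρ σ = wassersteinOneNeighbor ρ σ :=
  le_antisymm (wassersteinOne_le_wassersteinOneNeighbor ρ σ)
    (wassersteinOneNeighbor_le_wassersteinOne hρ)

end Wasserstein

section MatrixHom

variable {ι : Type*} [Fintype ι] [DecidableEq ι] {κ : ι → Type*} [∀ i, Fintype (κ i)]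
  [∀ i, DecidableEq (κ i)] {H : ι → Type*} [∀ i, NormedAddCommGroup (H i)]
  [∀ i, InnerProductSpace ℂ (H i)] [∀ i, CompleteSpace (H i)]
  (π : ∀ i, CStarMatrix (κ i) (κ i) ℂ →⋆ₐ[ℂ] (H i →L[ℂ] H i))

/-- The linear map from the matrices indexed by `∏ᵢ κᵢ` to `⊗ᵢ M_{κᵢ}(ℂ)` that sends matrix units
to the elementary tensors of matrix units. -/
def matrixLinearMap : Matrix (∀ i, κ i) (∀ i, κ i) ℂ →ₗ[ℂ] minTensor π :=
  Matrix.liftLinear ℂ fun k l => LinearMap.toSpanSingleton ℂ (minTensor π)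
    (elemTensor π fun i => CStarMatrix.ofMatrix (Matrix.single (k i) (l i) 1))

theorem matrixLinearMap_kron (a : ∀ i, CStarMatrix (κ i) (κ i) ℂ) :
    matrixLinearMap π (kron a) = elemTensor π a := by
  refine congrArg (fun f : MultilinearMap ℂ _ _ => f a) (multilinearMap_ext_single
    (f := (matrixLinearMap π).compMultilinearMap kronMultilinear)
    (g := elemTensorMultilinear π) fun k l => ?_)
  change matrixLinearMap π (kron _) = elemTensor π _
  rw [kron_single, matrixLinearMap, Matrix.liftLinear_single, LinearMap.toSpanSingleton_apply,
    one_smul]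

theorem matrixLinearMap_mul (M N : Matrix (∀ i, κ i) (∀ i, κ i) ℂ) :
    matrixLinearMap π (M * N) = matrixLinearMap π M * matrixLinearMap π N := by
  suffices h : (LinearMap.mul ℂ (Matrix (∀ i, κ i) (∀ i, κ i) ℂ)).compr₂ (matrixLinearMap π) =
      (LinearMap.mul ℂ (minTensor π)).compl₁₂ (matrixLinearMap π) (matrixLinearMap π) from
    LinearMap.congr_fun₂ h M N
  refine linearMap_ext_kron fun a => linearMap_ext_kron fun b => ?_
  change matrixLinearMap π (kron a * kron b) =
    matrixLinearMap π (kron a) * matrixLinearMap π (kron b)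
  simp only [← kron_mul, matrixLinearMap_kron, elemTensor_mul]

theorem matrixLinearMap_star (M : Matrix (∀ i, κ i) (∀ i, κ i) ℂ) :
    matrixLinearMap π (star M) = star (matrixLinearMap π M) := by
  suffices h : (starLinearEquiv ℂ (A := minTensor π)).toLinearMap.comp ((matrixLinearMap π).comp
      (starLinearEquiv ℂ (A := Matrix (∀ i, κ i) (∀ i, κ i) ℂ)).toLinearMap) =
      matrixLinearMap π from
    (star_star _).symm.trans (congrArg star (LinearMap.congr_fun h M))
  refine linearMap_ext_kron fun a => ?_
  change star (matrixLinearMap π (star (kron a))) = matrixLinearMap π (kron a)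
  rw [← kron_star, matrixLinearMap_kron, matrixLinearMap_kron, elemTensor_star, star_star]

/-- The *-homomorphism from the algebra of matrices indexed by `∏ᵢ κᵢ` to `⊗ᵢ M_{κᵢ}(ℂ)` with
`kron a ↦ ⊗ᵢ aᵢ`. It is an isomorphism unless `⊗ᵢ Hᵢ = 0`. -/
def matrixHom : Matrix (∀ i, κ i) (∀ i, κ i) ℂ →⋆ₐ[ℂ] minTensor π where
  toAlgHom := AlgHom.ofLinearMap (matrixLinearMap π)
    (by rw [← kron_one, matrixLinearMap_kron]; exact elemTensor_one π) (matrixLinearMap_mul π)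
  map_star' := matrixLinearMap_star π

theorem matrixHom_kron (a : ∀ i, CStarMatrix (κ i) (κ i) ℂ) :
    matrixHom π (kron a) = elemTensor π a :=
  matrixLinearMap_kron π a

theorem matrixHom_injective [Nontrivial (minTensor π)] : Function.Injective (matrixHom π) := by
  cases isEmpty_or_nonempty (∀ i, κ i)
  · exact Function.injective_of_subsingleton _
  · exact (matrixHom π : Matrix (∀ i, κ i) (∀ i, κ i) ℂ →+* minTensor π).injective

theorem matrixHom_surjective : Function.Surjective (matrixHom π) := by
  have hclosed : IsClosed (LinearMap.range (matrixLinearMap π) : Set (minTensor π)) :=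
    Submodule.closed_of_finiteDimensional _
  have hspan : Submodule.span ℂ (Set.range (elemTensor π)) ≤ LinearMap.range (matrixLinearMap π) :=
    Submodule.span_le.2 (Set.range_subset_iff.2 fun a => ⟨kron a, matrixLinearMap_kron π a⟩)
  exact fun x => closure_minimal hspan hclosed (dense_span_range_elemTensor π x)

end MatrixHom

section GivenBy

variable {ι : Type*} [Fintype ι] [DecidableEq ι] {κ : ι → Type*} [∀ i, Fintype (κ i)]
  [∀ i, DecidableEq (κ i)] {H : ι → Type*} [∀ i, NormedAddCommGroup (H i)]
  [∀ i, InnerProductSpace ℂ (H i)] [∀ i, CompleteSpace (H i)]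
  {π : ∀ i, CStarMatrix (κ i) (κ i) ℂ →⋆ₐ[ℂ] (H i →L[ℂ] H i)}
  {φ ψ : minTensor π →L[ℂ] ℂ} {X Y : Matrix (∀ i, κ i) (∀ i, κ i) ℂ}

theorem isGivenBy_iff : IsGivenBy π φ X ↔ ∀ M, φ (matrixHom π M) = (X * M).trace := by
  refine ⟨fun h => LinearMap.congr_fun (linearMap_ext_kron
      (f := φ.toLinearMap ∘ₗ (matrixHom π).toAlgHom.toLinearMap)
      (g := Matrix.traceLinearMap _ ℂ ℂ ∘ₗ LinearMap.mulLeft ℂ X)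
      fun a => (congrArg φ (matrixHom_kron π a)).trans (h a)),
    fun h a => by rw [← matrixHom_kron, h]⟩

theorem existsUnique_matrix_isGivenBy (φ : minTensor π →L[ℂ] ℂ) : ∃! X, IsGivenBy π φ X := by
  let X : Matrix (∀ i, κ i) (∀ i, κ i) ℂ :=
    Matrix.of fun k l => φ (matrixHom π (Matrix.single l k 1))
  have hX : IsGivenBy π φ X := isGivenBy_iff.2 <| LinearMap.congr_fun
    (f := φ.toLinearMap ∘ₗ (matrixHom π).toAlgHom.toLinearMap)
    (g := Matrix.traceLinearMap _ ℂ ℂ ∘ₗ LinearMap.mulLeft ℂ X) <|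
    Matrix.ext_linearMap (R := ℂ) fun k l => LinearMap.ext_ring
      (by simp [X, Matrix.trace_mul_single])
  exact ⟨X, hX, fun Y hY => ext_trace_mul_kron fun a => by rw [← hY, ← hX]⟩

theorem existsUnique_functional_isGivenBy [Nontrivial (minTensor π)]
    (X : Matrix (∀ i, κ i) (∀ i, κ i) ℂ) : ∃! φ : minTensor π →L[ℂ] ℂ, IsGivenBy π φ X := by
  let e : Matrix (∀ i, κ i) (∀ i, κ i) ℂ ≃ₗ[ℂ] minTensor π := LinearEquiv.ofBijective
    (matrixHom π).toAlgHom.toLinearMap ⟨matrixHom_injective π, matrixHom_surjective π⟩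
  have : FiniteDimensional ℂ (minTensor π) := e.finiteDimensional
  let φ : minTensor π →L[ℂ] ℂ := LinearMap.toContinuousLinearMap
    (Matrix.traceLinearMap _ ℂ ℂ ∘ₗ LinearMap.mulLeft ℂ X ∘ₗ e.symm.toLinearMap)
  have hφ : IsGivenBy π φ X := isGivenBy_iff.2 fun M =>
    congrArg (fun N => (X * N).trace) (e.symm_apply_apply M)
  exact ⟨φ, hφ, fun ψ hψ => clm_ext_elemTensor π fun a => (hψ a).trans (hφ a).symm⟩

theorem IsGivenBy.apply_one (h : IsGivenBy π φ X) : φ 1 = X.trace := by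
  rw [← elemTensor_one, h, kron_one, mul_one]

theorem IsGivenBy.sub (hφ : IsGivenBy π φ X) (hψ : IsGivenBy π ψ Y) :
    IsGivenBy π (φ - ψ) (X - Y) := fun a => by
  rw [sub_apply, hφ, hψ, sub_mul, Matrix.trace_sub]

theorem IsGivenBy.sum {α : Type*} {s : Finset α} {φ : α → minTensor π →L[ℂ] ℂ}
    {X : α → Matrix (∀ i, κ i) (∀ i, κ i) ℂ} (h : ∀ j ∈ s, IsGivenBy π (φ j) (X j)) :
    IsGivenBy π (∑ j ∈ s, φ j) (∑ j ∈ s, X j) := fun a => by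
  rw [sum_apply, Finset.sum_mul, Matrix.trace_sum]
  exact Finset.sum_congr rfl fun j hj => h j hj a

theorem IsGivenBy.eq_iff (hφ : IsGivenBy π φ X) (hψ : IsGivenBy π ψ Y) : φ = ψ ↔ X = Y := by
  constructor
  · rintro rfl
    exact (existsUnique_matrix_isGivenBy φ).unique hφ hψ
  · rintro rfl
    exact clm_ext_elemTensor π fun a => (hφ a).trans (hψ a).symm

theorem IsGivenBy.isSelfAdjointFunctional_iff (h : IsGivenBy π φ X) :
    IsSelfAdjointFunctional φ ↔ X.IsHermitian := by
  have hadj (M) : starRingEnd ℂ (φ (star (matrixHom π M))) = (X.conjTranspose * M).trace := by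
    rw [← map_star, isGivenBy_iff.1 h, starRingEnd_apply, ← Matrix.trace_conjTranspose,
      Matrix.conjTranspose_mul, Matrix.star_eq_conjTranspose, Matrix.conjTranspose_conjTranspose,
      Matrix.trace_mul_comm]
  rw [IsSelfAdjointFunctional, (matrixHom_surjective π).forall, Matrix.IsHermitian,
    Matrix.ext_iff_trace_mul_right]
  exact forall_congr' fun M => by rw [hadj, isGivenBy_iff.1 h]

open scoped MatrixOrder in
theorem IsGivenBy.nonneg_iff_posSemidef (h : IsGivenBy π φ X) :
    (∀ b, 0 ≤ φ (star b * b)) ↔ X.PosSemidef := by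
  have hsq (M) : φ (star (matrixHom π M) * matrixHom π M) = (X * (star M * M)).trace := by
    rw [← map_star, ← map_mul, isGivenBy_iff.1 h]
  refine ⟨fun hpos => .of_dotProduct_mulVec_nonneg (h.isSelfAdjointFunctional_iff.1
    (isSelfAdjointFunctional_minTensor_of_nonneg hpos)) fun x => ?_, fun hX => ?_⟩
  · obtain ⟨B, hB⟩ := CStarAlgebra.nonneg_iff_eq_star_mul_self.1
      (Matrix.posSemidef_vecMulVec_self_star x).nonneg
    have hx := hpos (matrixHom π B)
    rwa [hsq, ← hB, Matrix.mul_vecMulVec, Matrix.trace_vecMulVec, dotProduct_comm] at hx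
  · rw [(matrixHom_surjective π).forall]
    intro M
    rw [hsq, ← mul_assoc, Matrix.trace_mul_comm, ← mul_assoc]
    exact (hX.mul_mul_conjTranspose_same M).trace_nonneg

theorem IsGivenBy.isState_iff (h : IsGivenBy π φ X) : IsState φ ↔ IsDensityMatrix X := by
  rw [isState_minTensor_iff, h.nonneg_iff_posSemidef, h.apply_one, IsDensityMatrix]

theorem IsGivenBy.eq_zero_on_tilde_iff (h : IsGivenBy π φ X) (i : ι) :
    (∀ c ∈ tilde π i, φ c = 0) ↔ partialTrace i X = 0 := by
  rw [QHamming.eq_zero_on_tilde_iff, partialTrace_eq_zero_iff]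
  exact forall₂_congr fun a _ => by rw [h a]

theorem norm_matrixHom_eq_one [Nontrivial (minTensor π)] {S : Matrix (∀ i, κ i) (∀ i, κ i) ℂ}
    (hS : S ∈ unitary (Matrix (∀ i, κ i) (∀ i, κ i) ℂ)) : ‖matrixHom π S‖ = 1 :=
  CStarRing.norm_of_mem_unitary (Unitary.map_mem (matrixHom π) hS)

theorem IsGivenBy.opNorm_eq_traceNorm [Nontrivial (minTensor π)] (h : IsGivenBy π φ X)
    (hX : X.IsHermitian) : ‖φ‖ = traceNorm X := by
  apply le_antisymm
  · obtain ⟨P, N, hP, hN, hPN, htr⟩ := exists_posSemidef_sub_eq hX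
    have hnorm {Q : Matrix (∀ i, κ i) (∀ i, κ i) ℂ} {ψ : minTensor π →L[ℂ] ℂ} (hQ : Q.PosSemidef)
        (hψ : IsGivenBy π ψ Q) : (‖ψ‖ : ℂ) = Q.trace := by
      rw [@opNorm_eq_norm_apply_one (minTensor π) (minTensorCStarAlgebra π) ψ
        (hψ.nonneg_iff_posSemidef.2 hQ), hψ.apply_one]
      exact Complex.norm_of_nonneg' hQ.trace_nonneg
    obtain ⟨p, hp, -⟩ := existsUnique_functional_isGivenBy (π := π) P
    obtain ⟨q, hq, -⟩ := existsUnique_functional_isGivenBy (π := π) N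
    have htr' : traceNorm X = ‖p‖ + ‖q‖ := by
      rw [← hnorm hP hp, ← hnorm hN hq] at htr
      exact_mod_cast htr
    rw [(h.eq_iff (hp.sub hq)).2 hPN, htr']
    exact norm_sub_le p q
  · obtain ⟨S, hS, hS2, habs⟩ := exists_isHermitian_mul_eq_abs hX
    have htr : φ (matrixHom π S) = traceNorm X := by
      rw [isGivenBy_iff.1 h, habs, coe_traceNorm]
    have hunitary : S ∈ unitary (Matrix (∀ i, κ i) (∀ i, κ i) ℂ) := by
      rw [Unitary.mem_iff, Matrix.star_eq_conjTranspose, hS.eq]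
      exact ⟨hS2, hS2⟩
    calc traceNorm X = ‖φ (matrixHom π S)‖ := by
          rw [htr, Complex.norm_real, Real.norm_of_nonneg (traceNorm_nonneg X)]
      _ ≤ ‖φ‖ * ‖matrixHom π S‖ := φ.le_opNorm _
      _ = ‖φ‖ := by rw [norm_matrixHom_eq_one hunitary, mul_one]

theorem IsGivenBy.dualNorm_eq_traceNorm [Nontrivial (minTensor π)] (h : IsGivenBy π φ X)
    (hX : X.IsHermitian) {i : ι} (hi : partialTrace i X = 0) :
    dualNorm π i φ = ENNReal.ofReal (1 / 2 * traceNorm X) := by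
  rw [dualNorm_eq_ofReal_opNorm ((h.eq_zero_on_tilde_iff i).2 hi), h.opNorm_eq_traceNorm hX,
    one_div_mul_eq_div]

end GivenBy

section Correspondence

variable {ι : Type*} [Fintype ι] {H : ι → Type*} [∀ i, NormedAddCommGroup (H i)]
  [∀ i, InnerProductSpace ℂ (H i)] [∀ i, CompleteSpace (H i)]

theorem nontrivial_of_isState {A : ι → Type*} [∀ i, CStarAlgebra (A i)]
    {π : ∀ i, A i →⋆ₐ[ℂ] (H i →L[ℂ] H i)} {μ : minTensor π →L[ℂ] ℂ} (hμ : IsState μ) :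
    Nontrivial (minTensor π) := by
  refine ⟨1, 0, fun h => zero_ne_one (α := ℂ) ?_⟩
  rw [← (isState_minTensor_iff.1 hμ).2, h, map_zero]

theorem nontrivial_minTensor {A : ι → Type*} [∀ i, CStarAlgebra (A i)] [∀ i, Nontrivial (A i)]
    {π : ∀ i, A i →⋆ₐ[ℂ] (H i →L[ℂ] H i)} (hπ : ∀ i, Function.Injective (π i)) :
    Nontrivial (minTensor π) := by
  have hop (i : ι) : Nontrivial (H i →L[ℂ] H i) := (hπ i).nontrivial
  have (i : ι) : Nontrivial (H i) := by
    by_contra h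
    rw [not_nontrivial_iff_subsingleton] at h
    exact not_subsingleton (H i →L[ℂ] H i) inferInstance
  have := nontrivial_hilbertTensor (H := H)
  exact ⟨1, 0, fun h =>
    one_ne_zero (α := HilbertTensor H →L[ℂ] HilbertTensor H) (congrArg Subtype.val h)⟩

variable [DecidableEq ι] {κ : ι → Type*} [∀ i, Fintype (κ i)] [∀ i, DecidableEq (κ i)]
  {π : ∀ i, CStarMatrix (κ i) (κ i) ℂ →⋆ₐ[ℂ] (H i →L[ℂ] H i)} {μ ν : minTensor π →L[ℂ] ℂ}
  {ρ σ : Matrix (∀ i, κ i) (∀ i, κ i) ℂ}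

theorem existsUnique_isDensityMatrix (hμ : IsState μ) :
    ∃! ρ, IsDensityMatrix ρ ∧ IsGivenBy π μ ρ := by
  obtain ⟨ρ, hρ, huniq⟩ := existsUnique_matrix_isGivenBy μ
  exact ⟨ρ, ⟨hρ.isState_iff.1 hμ, hρ⟩, fun σ hσ => huniq σ hσ.2⟩

theorem existsUnique_isState (hπ : ∀ i, Function.Injective (π i)) (hρ : IsDensityMatrix ρ) :
    ∃! μ : minTensor π →L[ℂ] ℂ, IsState μ ∧ IsGivenBy π μ ρ := by
  have : Nonempty (∀ i, κ i) := by
    by_contra hempty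
    rw [not_nonempty_iff] at hempty
    exact zero_ne_one ((Matrix.trace_eq_zero_of_isEmpty ρ).symm.trans hρ.2)
  have (i : ι) : Nonempty (κ i) := this.map fun k => k i
  have (i : ι) : Nontrivial (CStarMatrix (κ i) (κ i) ℂ) :=
    inferInstanceAs (Nontrivial (Matrix (κ i) (κ i) ℂ))
  have := nontrivial_minTensor hπ
  obtain ⟨μ, hμ, huniq⟩ := existsUnique_functional_isGivenBy (π := π) ρ
  exact ⟨μ, ⟨hμ.isState_iff.2 hρ, hμ⟩, fun ν hν => huniq ν hν.2⟩

theorem hammingDist_eq_wassersteinOne (hμ : IsState μ) (hν : IsState ν)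
    (hμρ : IsGivenBy π μ ρ) (hνσ : IsGivenBy π ν σ) :
    hammingDist π μ ν = wassersteinOne ρ σ := by
  have := nontrivial_of_isState hμ
  have hcost {φ : ι → minTensor π →L[ℂ] ℂ} {X : ι → Matrix (∀ i, κ i) (∀ i, κ i) ℂ}
      (hφ : ∀ i, IsGivenBy π (φ i) (X i))
      (hX : ∀ i, (X i).IsHermitian ∧ partialTrace i (X i) = 0) :
      ∑ i, dualNorm π i (φ i) = ENNReal.ofReal (1 / 2 * ∑ i, traceNorm (X i)) := by
    rw [Finset.mul_sum, ENNReal.ofReal_sum_of_nonneg fun i _ =>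
      mul_nonneg one_half_pos.le (traceNorm_nonneg (X i))]
    exact Finset.sum_congr rfl fun i _ => (hφ i).dualNorm_eq_traceNorm (hX i).1 (hX i).2
  have hadm {φ : ι → minTensor π →L[ℂ] ℂ} {X : ι → Matrix (∀ i, κ i) (∀ i, κ i) ℂ}
      (hφ : ∀ i, IsGivenBy π (φ i) (X i)) :
      ((∀ i, (∀ c ∈ tilde π i, φ i c = 0) ∧ IsSelfAdjointFunctional (φ i)) ∧
          μ - ν = ∑ i, φ i) ↔
        (∀ i, (X i).IsHermitian ∧ partialTrace i (X i) = 0) ∧ ρ - σ = ∑ i, X i := by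
    rw [(hμρ.sub hνσ).eq_iff (.sum fun i _ => hφ i)]
    simp only [(hφ _).eq_zero_on_tilde_iff, (hφ _).isSelfAdjointFunctional_iff, and_comm]
  rw [hammingDist_eq_iInf_sum_dualNorm
    ((isState_minTensor_iff.1 hμ).2.trans (isState_minTensor_iff.1 hν).2.symm)
    (hμ.sub_isSelfAdjointFunctional hν)]
  refine le_antisymm (le_iInf₂ fun X hX => ?_) (le_iInf₂ fun φ hφ => ?_)
  · choose φ hφ _ using fun i => existsUnique_functional_isGivenBy (π := π) (X i)
    exact (iInf₂_le φ ((hadm hφ).2 hX)).trans_eq (hcost hφ hX.1)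
  · choose X hX _ using fun i => existsUnique_matrix_isGivenBy (φ i)
    have hXadm := (hadm hX).1 hφ
    exact (iInf₂_le X hXadm).trans_eq (hcost hX hXadm.1).symm

end Correspondence

end QHamming

end

theorem mainTheorem8 {ι : Type*} [Fintype ι] [DecidableEq ι] :
    (∀ (A : ι → Type*) [∀ i, CStarAlgebra (A i)] (H : ι → Type*) [∀ i, NormedAddCommGroup (H i)]
        [∀ i, InnerProductSpace ℂ (H i)] [∀ i, CompleteSpace (H i)]
        (π : ∀ i, A i →⋆ₐ[ℂ] (H i →L[ℂ] H i)), (∀ i, Function.Injective (π i)) →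
      ∀ μ ν : QHamming.minTensor π →L[ℂ] ℂ, QHamming.IsState μ → QHamming.IsState ν →
        QHamming.hammingDist π μ ν ≠ ⊤ ∧
        QHamming.hammingDist π μ ν =
          ⨅ (φ : ι → (QHamming.minTensor π →L[ℂ] ℂ))
            (_ : (∀ i, (∀ c ∈ QHamming.tilde π i, φ i c = 0) ∧ QHamming.IsSelfAdjointFunctional (φ i)) ∧
              μ - ν = ∑ i, φ i),
            ∑ i, QHamming.dualNorm π i (φ i)) ∧
    (∀ (κ : ι → Type*) [∀ i, Fintype (κ i)] [∀ i, DecidableEq (κ i)]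
        (H : ι → Type*) [∀ i, NormedAddCommGroup (H i)]
        [∀ i, InnerProductSpace ℂ (H i)] [∀ i, CompleteSpace (H i)]
        (π : ∀ i, CStarMatrix (κ i) (κ i) ℂ →⋆ₐ[ℂ] (H i →L[ℂ] H i)),
        (∀ i, Function.Injective (π i)) →
      (∀ μ : QHamming.minTensor π →L[ℂ] ℂ, QHamming.IsState μ → ∃! ρ, QHamming.IsDensityMatrix ρ ∧ QHamming.IsGivenBy π μ ρ) ∧
      (∀ ρ, QHamming.IsDensityMatrix ρ → ∃! μ : QHamming.minTensor π →L[ℂ] ℂ, QHamming.IsState μ ∧ QHamming.IsGivenBy π μ ρ) ∧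
      (∀ (μ ν : QHamming.minTensor π →L[ℂ] ℂ) (ρ σ : Matrix (∀ i, κ i) (∀ i, κ i) ℂ),
        QHamming.IsState μ → QHamming.IsState ν → QHamming.IsDensityMatrix ρ → QHamming.IsDensityMatrix σ →
        QHamming.IsGivenBy π μ ρ → QHamming.IsGivenBy π ν σ →
        QHamming.hammingDist π μ ν = QHamming.wassersteinOne ρ σ ∧
        QHamming.hammingDist π μ ν = QHamming.wassersteinOneNeighbor ρ σ)) := by
  refine ⟨fun A _ H _ _ _ π _ μ ν hμ hν => ?_, fun κ _ _ H _ _ _ π hπ => ⟨fun μ hμ => ?_,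
    fun ρ hρ => ?_, fun μ ν ρ σ hμ hν hρ _ hμρ hνσ => ?_⟩⟩
  · have hunit : μ 1 = ν 1 :=
      (QHamming.isState_minTensor_iff.1 hμ).2.trans (QHamming.isState_minTensor_iff.1 hν).2.symm
    exact ⟨QHamming.hammingDist_ne_top hunit,
      QHamming.hammingDist_eq_iInf_sum_dualNorm hunit (hμ.sub_isSelfAdjointFunctional hν)⟩
  · exact QHamming.existsUnique_isDensityMatrix hμ
  · exact QHamming.existsUnique_isState hπ hρ
  · rw [← QHamming.wassersteinOne_eq_wassersteinOneNeighbor hρ]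
    exact ⟨QHamming.hammingDist_eq_wassersteinOne hμ hν hμρ hνσ,
      QHamming.hammingDist_eq_wassersteinOne hμ hν hμρ hνσ⟩
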